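/- **Setting.** Let $X_1,X_2,\dots$ be iid real random variables with distribution function $F$, and let $F^{\leftarrow}(p)=\inf\{x:F(x)\ge p\}$ for $p\in(0,1)$, with $F^{\leftarrow}(0)$ the left end-point of $F$; the same notation is used for other distribution functions. Put $Q=F^{\leftarrow}$. For $\gamma,x\in\mathbb R$ let $H_\gamma(x)=1-(1+\gamma x)_+^{-1/\gamma}$ for $x>0$ (read as $1-e^{-x}$ if $\gamma=0$) and $H_\gamma(x)=0$ for $x\le 0$; for $\theta=(\gamma,\sigma)$ let $H_\theta(x)=H_\gamma(x/\sigma)$. For $x>0$ let $w_\gamma(x)=\log x$ if $\gamma>0$, $w_\gamma(x)=\log^2x$ if $\gamma=0$, and $w_\gamma(x)=x^{-\gamma}$ if $\gamma<0$. **Assumptions.** Fix $\gamma>-1/2$, $\rho\le 0$ and an eventually positive scaling function $a$. 1. (Second-order von Mises condition.) $F$ is twice differentiable to the left of its right end-point (in a neighbourhood of it), $Q$ is twice differentiable in a left neighbourhood of $1$, and $$A(t)=\frac{Q''(1-1/t)/t-2Q'(1-1/t)}{Q'(1-1/t)}+1-\gamma$$ satisfies: $A(t)\to0$ as $t\to\infty$,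 $|A|$ is regularly varying at infinity with index $\rho$, and for all $x>0$ $$\lim_{u\downarrow0}\frac1{A(1/u)}\left(\frac{Q(1-ux)-Q(1-u)}{a(1/u)}-\frac{x^{-\gamma}-1}{\gamma}\right)=\int_1^{1/x}v^{\gamma-1}\int_1^vr^{\rho-1}\,dr\,dv,$$ where $(x^{-\gamma}-1)/\gamma$ is read as $-\log x$ if $\gamma=0$. 2. $k=k_n\in\mathbb N$ with $k\to\infty$ and $k=o(n)$; $\nu=\nu_n\in(0,k]$; $\tau_I=1-k/n$, $\tau_E=1-\nu/n$, and $\tau^\star=(1-\tau_E)/(1-\tau_I)\to\tau_0\in[0,1]$. If $\rho=\tau_0=0$, then $|A|$ is nonincreasing near infinity. 3. $\widehat\gamma_n$ and $\widehat\sigma_n$ are measurable functions of the upper order statistics $(X_{n-k,n},\dots,X_{n,n})$ with $|\widehat\gamma_n-\gamma|=O_{\mathbb P}(1/\sqrt k)$ and $|\widehat\sigma_n/a(n/k)-1|=O_{\mathbb P}(1/\sqrt k)$. 4. $\sqrt k\,|A(n/k)|\to\lambda\in(0,\infty)$ and $w_\gamma(1/\tau^\star)=o(\sqrt k)$. Put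 $t_I=Q(\tau_I)$, let $F^\star_{t_I}(y)=\mathbb P(X_{n+1}\le y\mid X_{n+1}>t_I,X_1,\dots,X_n)$ be the predictive distribution function of tail events, and $Q^\star_{t_I}=(F^\star_{t_I})^{\leftarrow}$. The frequentist forecasters are $$\widehat H^{(F)}_{\tau_I}(y)=H_{(\widehat\gamma_n,\widehat\sigma_n)}(y-X_{n-k,n}),\qquad \widehat F^{(F)}_n=\tau_I+(1-\tau_I)\widehat H^{(F)}_{\tau_I}.$$ **Conclusion.** (a) $\widehat H^{(F)}_{\tau_I}$ is $\tau^\star$-tail equivalent to $F^\star_{t_I}$ and $\widehat F^{(F)}_n$ is $(1-\tau_E)$-tail equivalent to $F$, that is, as $n\to\infty$, $$\frac{1-\widehat H^{(F)}_{\tau_I}(Q^\star_{t_I}(1-\tau^\star))}{\tau^\star}=1+o_{\mathbb P}(1),\qquad \frac{1-\widehat F^{(F)}_n(Q(\tau_E))}{1-\tau_E}=1+o_{\mathbb P}(1).$$ (b) Let $\epsilon_n>0$ be any sequence with $\epsilon_n\to0$, $k\epsilon_n^2\to\infty$ and $w_\gamma(1/\tau^\star)\epsilon_n\to0$. In the degenerate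 case $\gamma\ge0$, $\tau_0=1$ (in which $w_\gamma(1/\tau^\star)\to0$) assume in addition that $1/\sqrt k=O(\epsilon_n w_\gamma(1/\tau^\star))$. Then $$\frac{1-\widehat H^{(F)}_{\tau_I}(Q^\star_{t_I}(1-\tau^\star))}{\tau^\star}=1+O_{\mathbb P}(\epsilon_nw_\gamma(1/\tau^\star)),\qquad \frac{1-\widehat F^{(F)}_n(Q(\tau_E))}{1-\tau_E}=1+O_{\mathbb P}(\epsilon_nw_\gamma(1/\tau^\star)).$$ -/

import Mathlib

open MeasureTheory ProbabilityTheory Filter Topology Asymptotics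

noncomputable section

namespace TailForecast

/-! ### Distribution functions, quantiles, generalized Pareto law -/

/-- Quantile function `F^←(p) = inf {x : F x ≥ p}` of a distribution function, for `p ∈ (0, 1)`.
The clause `0 < F x` is redundant for `p > 0`; it only makes `F^←(0)` the left end-point of `F`
(the limit of `F^←(p)` as `p ↓ 0`), the infimum over all of `ℝ` being no real number. -/
def quantile (F : ℝ → ℝ) (p : ℝ) : ℝ := sInf {x : ℝ | 0 < F x ∧ p ≤ F x}

/-- Standard generalized Pareto distribution function `H_γ`: it vanishes on `(-∞, 0]`, is
`1 - (1 + γ x)^(-1/γ)` on the support (read as `1 - exp (-x)` if `γ = 0`), and equals `1` to the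
right of the end-point `-1/γ` if `γ < 0`. -/
def gpStd (γ x : ℝ) : ℝ :=
  if x ≤ 0 then 0
  else if γ = 0 then 1 - Real.exp (-x)
  else 1 - (max 0 (1 + γ * x)) ^ (-1 / γ)

/-- Generalized Pareto distribution function `H_θ(x) = H_γ(x / σ)` with `θ = (γ, σ)`. -/
def gpCDF (γ σ x : ℝ) : ℝ := gpStd γ (x / σ)

/-- The limit `(x^(-γ) - 1) / γ` of the first-order condition, read as `-log x` if `γ = 0`. -/
def gpTailQuantile (γ x : ℝ) : ℝ :=
  if γ = 0 then -Real.log x else (x ^ (-γ) - 1) / γ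

/-- The weight `w_γ`. -/
def weight (γ x : ℝ) : ℝ :=
  if 0 < γ then Real.log x else if γ = 0 then Real.log x ^ 2 else x ^ (-γ)

/-! ### Second-order conditions -/

/-- `f` is regularly varying at infinity with index `ρ`. -/
def RegularlyVarying (f : ℝ → ℝ) (ρ : ℝ) : Prop :=
  ∀ x : ℝ, 0 < x → Tendsto (fun t => f (t * x) / f t) atTop (𝓝 (x ^ ρ))

/-- Second-order condition for the quantile function `Q`, with scaling function `a`, rate function
`A`, extreme value index `γ` and second-order parameter `ρ`. -/
structure SecondOrder (Q a A : ℝ → ℝ) (γ ρ : ℝ) : Prop where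
  a_pos : ∀ᶠ t in atTop, 0 < a t
  A_tendsto : Tendsto A atTop (𝓝 0)
  rho_nonpos : ρ ≤ 0
  A_regVar : RegularlyVarying (fun t => |A t|) ρ
  expansion : ∀ x : ℝ, 0 < x →
    Tendsto
      (fun u => 1 / A (1 / u) *
        ((Q (1 - u * x) - Q (1 - u)) / a (1 / u) - gpTailQuantile γ x))
      (𝓝[>] 0)
      (𝓝 (∫ v in (1 : ℝ)..(1 / x), v ^ (γ - 1) * ∫ r in (1 : ℝ)..v, r ^ (ρ - 1)))

/-- The von Mises rate function
`A(t) = (Q''(1 - 1/t) / t - 2 Q'(1 - 1/t)) / Q'(1 - 1/t) + 1 - γ`. -/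
def vonMisesRate (Q : ℝ → ℝ) (γ t : ℝ) : ℝ :=
  (deriv (deriv Q) (1 - 1 / t) / t - 2 * deriv Q (1 - 1 / t)) / deriv Q (1 - 1 / t) + 1 - γ

/-- Second-order von Mises condition for a distribution function `F`: `F` is twice differentiable
to the left of its right end-point, the two derivatives of the quantile function that enter the rate
function exist near `1`, and the second-order condition holds with the von Mises rate function. -/
structure SecondOrderVonMises (F a : ℝ → ℝ) (γ ρ : ℝ) : Prop where
  twice_diff : ∃ x₀, F x₀ < 1 ∧ ∀ x, x₀ ≤ x → F x < 1 →
    DifferentiableAt ℝ F x ∧ DifferentiableAt ℝ (deriv F) x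
  quantile_diff : ∀ᶠ p in 𝓝[<] (1 : ℝ),
    DifferentiableAt ℝ (quantile F) p ∧ DifferentiableAt ℝ (deriv (quantile F)) p
  secondOrder : SecondOrder (quantile F) a (vonMisesRate (quantile F) γ) γ ρ

/-! ### Sample, order statistics, forecasters -/

/-- The `i`-th order statistic `X_{i,n}`, `1 ≤ i ≤ n`, of `x₁, …, xₙ` (in increasing order). -/
def orderStat {n : ℕ} (x : Fin n → ℝ) (i : ℕ) : ℝ :=
  if h : 1 ≤ i ∧ i ≤ n then x (Tuple.sort x ⟨i - 1, by omega⟩) else 0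

/-- The vector `(X_{n-k,n}, …, X_{n,n})` of the `k + 1` largest order statistics, `k < n`. -/
def topOrderStats {n : ℕ} (k : ℕ) (x : Fin n → ℝ) : Fin (k + 1) → ℝ :=
  fun j => orderStat x (n - k + j)

variable {Ω : Type*} [MeasurableSpace Ω]

/-- The sample of size `n` from the sequence `X 0, X 1, …`; the next variable is `X n`. -/
def sample (X : ℕ → Ω → ℝ) (n : ℕ) (ω : Ω) : Fin n → ℝ := fun i => X i ω

/-- The predictive distribution function of tail events: the conditional probability that the
out-of-sample variable `X n` is at most `y`, given that `X n > t` and given the sample of size `n`,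
as a regular conditional distribution evaluated at the observed sample. -/
def predictiveCDF (μ : Measure Ω) [IsFiniteMeasure μ] (X : ℕ → Ω → ℝ) (n : ℕ) (t : ℝ) (ω : Ω)
    (y : ℝ) : ℝ :=
  (condDistrib (X n) (sample X n) (μ[|X n ⁻¹' Set.Ioi t]) (sample X n ω)).real (Set.Iic y)

/-- The intermediate level `τ_I = 1 - k / n`. -/
def tauI (k : ℕ → ℕ) (n : ℕ) : ℝ := 1 - (k n : ℝ) / n

/-- The extreme level `τ_E = 1 - ν / n`. -/
def tauE (ν : ℕ → ℝ) (n : ℕ) : ℝ := 1 - ν n / n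

/-- The ratio `τ* = (1 - τ_E) / (1 - τ_I)`. -/
def tauStar (k : ℕ → ℕ) (ν : ℕ → ℝ) (n : ℕ) : ℝ := (1 - tauE ν n) / (1 - tauI k n)

/-- The estimator obtained by applying the statistic `T n` to the `k n + 1` largest order
statistics of the sample of size `n`. -/
def estimator (X : ℕ → Ω → ℝ) (k : ℕ → ℕ) (T : ∀ n, (Fin (k n + 1) → ℝ) → ℝ) (n : ℕ) (ω : Ω) : ℝ :=
  T n (topOrderStats (k n) (sample X n ω))

/-- The frequentist forecaster for peaks above the intermediate threshold: the generalized Pareto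
distribution function with estimated parameters, located at the order statistic `X_{n-k,n}`. -/
def freqPeakForecaster (X : ℕ → Ω → ℝ) (k : ℕ → ℕ) (T₁ T₂ : ∀ n, (Fin (k n + 1) → ℝ) → ℝ)
    (n : ℕ) (ω : Ω) (y : ℝ) : ℝ :=
  gpCDF (estimator X k T₁ n ω) (estimator X k T₂ n ω) (y - orderStat (sample X n ω) (n - k n))

/-- The frequentist forecaster for tail events, `τ_I + (1 - τ_I) Ĥ_{τ_I}`. -/
def freqTailForecaster (X : ℕ → Ω → ℝ) (k : ℕ → ℕ) (T₁ T₂ : ∀ n, (Fin (k n + 1) → ℝ) → ℝ)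
    (n : ℕ) (ω : Ω) (y : ℝ) : ℝ :=
  tauI k n + (1 - tauI k n) * freqPeakForecaster X k T₁ T₂ n ω y

/-! ### Stochastic orders and tail equivalence -/

/-- `Y n = O_ℙ(r n)` as `n → ∞`. -/
def BigOP (μ : Measure Ω) (Y : ℕ → Ω → ℝ) (r : ℕ → ℝ) : Prop :=
  ∀ δ : ℝ, 0 < δ → ∃ M : ℝ, 0 < M ∧ ∀ᶠ n in atTop,
    μ {ω | M * |r n| < |Y n ω|} ≤ ENNReal.ofReal δ

/-- The ratio of the estimated to the true probability `p n` of exceeding the true quantile of level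
`1 - p n`, for a forecaster `Fhat` of the distribution functions `F` (which may depend on the
sample). -/
def tailRatio (p : ℕ → ℝ) (Fhat F : ℕ → Ω → ℝ → ℝ) (n : ℕ) (ω : Ω) : ℝ :=
  (1 - Fhat n ω (quantile (F n ω) (1 - p n))) / p n

/-- The forecaster `Fhat` is `p`-tail equivalent to `F`: the tail ratio is `1 + o_ℙ(1)`. -/
def TailEquivalent (μ : Measure Ω) (p : ℕ → ℝ) (Fhat F : ℕ → Ω → ℝ → ℝ) : Prop :=
  TendstoInMeasure μ (tailRatio p Fhat F) atTop (fun _ => 1)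

end TailForecast

end

/-! Write `U(t) = Q(1 - 1/t)`, `t = n/k`, `y = 1/τ*`, `δ = 1/√k`, so that `Q(τ_I) = U(t)` and
`Q(τ_E) = U(ty)`. For large `n` both tail ratios are almost surely the same variable `y (1 -
H_g(z))`, where `g` is the estimated index and `z = (U(ty) - X_{n-k,n}) / σ̂`. For the tail-event
forecaster this is algebra. For the peak forecaster, independence identifies the predictive law with
the law of exceedances of `t_I`, whose `(1 - τ*)`-quantile is `Q(τ_E)`.

The ratio is exactly 1 at `g = γ`, `z = b := (y^γ - 1)/γ`, so the theorem is a perturbation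
statement. Four errors enter, each of order `δ`: that of `g`, that of `σ̂ / a(t)`, the location
error `(X_{n-k,n} - U(t)) / (t U'(t))` (Chebyshev for the empirical distribution function,
`bigOP_orderStat_sub_quantile`), and the bias. The bias is controlled because the von Mises rate
satisfies `t U''/U' = γ - 1 + A(t)`: a bound on `|A|` over `[t, ty]` squeezes `U'`, hence the
increment of `U`, between powers (`VonMisesTail.increment_bounds`). The bound is uniform by regular
variation or monotonicity of `|A|` (`exists_rate_le`), and the balance condition makes it `O(δ)`.
The second-order expansion itself is needed only at one point, to compare `a(t)` with `t U'(t)`.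

Together `|z - b| = O(δ y^γ (1 + w_γ(y)))`, and `exists_abs_gpStd_ratio_sub_one_le` converts this
into the rate `δ (1 + w_γ(y))` for the ratio. The weight records how an index error is amplified: by
`log y` if `γ > 0`, by `log² y` if `γ = 0`, and by `y^(-γ)` if `γ < 0`, where the tail argument `1 +
γ b = y^γ` approaches zero at the end-point. The rate tends to 0, which gives (a), and is dominated
by `ε w_γ(y)`, which gives (b). -/

namespace TailForecast

/-! ### Uniform bounds for regularly varying functions -/

/-- If the increments of a measurable function converge pointwise, they are bounded above, locally
uniformly in the step. -/
theorem exists_increment_le {h : ℝ → ℝ} (hm : Measurable h) {ρ : ℝ}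
    (hh : ∀ u, Tendsto (fun s => h (s + u) - h s) atTop (𝓝 (ρ * u))) {L : ℝ} (hL : 0 < L) :
    ∃ C s₀, ∀ s, s₀ ≤ s → ∀ u, 0 ≤ u → u ≤ L → h (s + u) - h s ≤ C := by
  by_contra! hcon
  choose s hs u hu0 huL hsu using fun n : ℕ => hcon n n
  have hs_top : Tendsto s atTop atTop := tendsto_atTop_mono hs tendsto_natCast_atTop_atTop
  have hsu_top : Tendsto (fun n => s n + u n) atTop atTop :=
    tendsto_atTop_mono (fun n => le_add_of_nonneg_right (hu0 n)) hs_top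
  -- The limits `ρ y` with `0 ≤ y ≤ 2L` stay below `K` in absolute value with room to spare, so each
  -- such `y` satisfies the bound `K` from some index on.
  set K : ℝ := |ρ| * (2 * L) + 1 with hK
  have key : ∀ (r : ℕ → ℝ), Tendsto r atTop atTop → ∀ ℓ, 0 < ℓ → ℓ ≤ 2 * L →
      Tendsto (fun m : ℕ => volume {y ∈ Set.Icc 0 ℓ | ∀ n, m ≤ n → |h (r n + y) - h (r n)| ≤ K})
        atTop (𝓝 (ENNReal.ofReal ℓ)) := by
    intro r hr ℓ hℓ hℓL
    have hun : (⋃ m : ℕ, {y ∈ Set.Icc 0 ℓ | ∀ n, m ≤ n → |h (r n + y) - h (r n)| ≤ K})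
        = Set.Icc 0 ℓ := by
      ext y
      simp only [Set.mem_iUnion, Set.mem_ofPred_eq]
      refine ⟨fun ⟨_, hy, _⟩ => hy, fun hy => ?_⟩
      have h1 := ((hh y).comp hr).abs
      have h2 : |ρ * y| < K := by
        rw [abs_mul, abs_of_nonneg hy.1, hK]
        have := mul_le_mul_of_nonneg_left (hy.2.trans hℓL) (abs_nonneg ρ)
        linarith
      obtain ⟨m, hm⟩ := eventually_atTop.1 (h1.eventually (gt_mem_nhds h2))
      exact ⟨m, hy, fun n hn => (hm n hn).le⟩
    have := tendsto_measure_iUnion_atTop (μ := (volume : Measure ℝ))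
      (s := fun m : ℕ => {y ∈ Set.Icc 0 ℓ | ∀ n, m ≤ n → |h (r n + y) - h (r n)| ≤ K})
      (fun a b hab y hy => ⟨hy.1, fun n hn => hy.2 n (hab.trans hn)⟩)
    rw [hun, Real.volume_Icc, sub_zero] at this
    exact this
  have hV := key s hs_top (2 * L) (by linarith) le_rfl
  have hW := key _ hsu_top L hL (by linarith)
  -- The measures of the good sets tend to `2L` and `L`. The thresholds `3L/2` and `L/2` add up to
  -- exactly `2L`, the length of the interval containing `V` and the translate of `W`, so these must
  -- meet.
  have hV' := hV.eventually (lt_mem_nhds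
    ((ENNReal.ofReal_lt_ofReal_iff (by linarith)).2 (by linarith : 3 / 2 * L < 2 * L)))
  have hW' := hW.eventually (lt_mem_nhds
    ((ENNReal.ofReal_lt_ofReal_iff hL).2 (by linarith : L / 2 < L)))
  obtain ⟨m, hVm, hWm, hmK⟩ := (hV'.and (hW'.and
    (tendsto_natCast_atTop_atTop.eventually (eventually_gt_atTop (2 * K))))).exists
  set V := {y ∈ Set.Icc 0 (2 * L) | ∀ n, m ≤ n → |h (s n + y) - h (s n)| ≤ K}
  set W := {y ∈ Set.Icc 0 L | ∀ n, m ≤ n → |h (s n + u n + y) - h (s n + u n)| ≤ K}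
  have hWmeas : MeasurableSet W := by
    have : W = Set.Icc 0 L ∩
        ⋂ n, ⋂ (_ : m ≤ n), {y | |h (s n + u n + y) - h (s n + u n)| ≤ K} := by
      ext y; simp [W]
    rw [this]
    refine measurableSet_Icc.inter (MeasurableSet.iInter fun n => MeasurableSet.iInter fun _ => ?_)
    exact measurableSet_le
      (continuous_abs.measurable.comp ((hm.comp (measurable_const_add _)).sub_const _))
      measurable_const
  have hmp := measurePreserving_sub_right (volume : Measure ℝ) (u m)
  have hne : (V ∩ (fun y => y - u m) ⁻¹' W).Nonempty := by
    refine nonempty_inter_of_measure_lt_add volume (u := Set.Icc 0 (2 * L)) (hmp.measurable hWmeas)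
      (fun y hy => hy.1) (fun y hy => ?_) ?_
    · have h1 : y - u m ∈ Set.Icc 0 L := hy.1
      have h3 := hu0 m
      have h4 := huL m
      exact ⟨by linarith [h1.1], by linarith [h1.2]⟩
    · rw [hmp.measure_preimage hWmeas.nullMeasurableSet, Real.volume_Icc, sub_zero]
      refine lt_of_eq_of_lt ?_ (ENNReal.add_lt_add hVm hWm)
      rw [← ENNReal.ofReal_add (by linarith) (by linarith)]
      congr 1; ring
  -- At a common point, `h (s m + y)` is within `K` of both `h (s m)` and `h (s m + u m)`. Their
  -- difference is then at most `2K < m`, against the choice of `s m` and `u m`.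
  obtain ⟨y, hyV, hyW⟩ := hne
  have h1 := abs_le.1 (hyV.2 m le_rfl)
  have h2 : |h (s m + u m + (y - u m)) - h (s m + u m)| ≤ K := hyW.2 m le_rfl
  rw [show s m + u m + (y - u m) = s m + y by ring] at h2
  have h3 := abs_le.1 h2
  linarith [hsu m, h1.2, h3.1]

/-- Where `f` vanishes, the ratio at `x = 1` is `0 / 0 = 0`, which cannot happen near infinity since
its limit is 1. -/
theorem RegularlyVarying.eventually_ne_zero {f : ℝ → ℝ} {ρ : ℝ} (hf : RegularlyVarying f ρ) :
    ∀ᶠ t in atTop, f t ≠ 0 := by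
  have h1 := hf 1 one_pos
  rw [Real.one_rpow] at h1
  filter_upwards [h1.eventually_ne one_ne_zero] with t ht h0
  exact ht (by rw [h0, div_zero])

theorem RegularlyVarying.tendsto_log_increment {f : ℝ → ℝ} {ρ : ℝ} (hf : RegularlyVarying f ρ)
    (u : ℝ) : Tendsto (fun s => Real.log (f (Real.exp (s + u))) - Real.log (f (Real.exp s))) atTop
      (𝓝 (ρ * u)) := by
  have h1 := (((hf (Real.exp u) (Real.exp_pos u)).comp Real.tendsto_exp_atTop).log
    (by positivity))
  rw [Real.log_rpow (Real.exp_pos u), Real.log_exp] at h1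
  have hne := Real.tendsto_exp_atTop.eventually hf.eventually_ne_zero
  have hne' := (tendsto_atTop_add_const_right atTop u tendsto_id).eventually hne
  refine h1.congr' ?_
  filter_upwards [hne, hne'] with s hs hs'
  simp only [Function.comp, id] at hs' ⊢
  rw [← Real.exp_add, Real.log_div hs' hs]

/-- Local Potter-type upper bound. -/
theorem RegularlyVarying.exists_le_mul {f : ℝ → ℝ} {ρ : ℝ} (hm : Measurable f) (hf0 : ∀ t, 0 ≤ f t)
    (hf : RegularlyVarying f ρ) (V : ℝ) :
    ∃ C t₀, 0 < C ∧ ∀ t, t₀ ≤ t → ∀ v, 1 ≤ v → v ≤ V → f (t * v) ≤ C * f t := by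
  obtain ⟨C, s₀, hC⟩ := exists_increment_le
    (Real.measurable_log.comp (hm.comp Real.measurable_exp)) hf.tendsto_log_increment
    (L := max 1 (Real.log V)) (by positivity)
  obtain ⟨t₁, ht₁⟩ := eventually_atTop.1 hf.eventually_ne_zero
  refine ⟨Real.exp C, max t₁ (Real.exp s₀), Real.exp_pos _, fun t ht v hv hvV => ?_⟩
  have ht0 : 0 < t := (Real.exp_pos s₀).trans_le ((le_max_right _ _).trans ht)
  have htv : t ≤ t * v := le_mul_of_one_le_right ht0.le hv
  have p1 : 0 < f t := lt_of_le_of_ne (hf0 t) (ht₁ t ((le_max_left _ _).trans ht)).symm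
  have p2 : 0 < f (t * v) :=
    lt_of_le_of_ne (hf0 _) (ht₁ _ ((le_max_left _ _).trans (ht.trans htv))).symm
  have := hC (Real.log t) ((Real.le_log_iff_exp_le ht0).2 ((le_max_right _ _).trans ht))
    (Real.log v) (Real.log_nonneg hv) ((Real.log_le_log (by linarith) hvV).trans (le_max_right _ _))
  simp only [Function.comp, Real.exp_add] at this
  rw [Real.exp_log ht0, Real.exp_log (by linarith)] at this
  rw [← Real.log_le_log_iff p2 (by positivity), Real.log_mul (Real.exp_ne_zero _) p1.ne',
    Real.log_exp]
  linarith

/-- A regularly varying function of negative index is bounded, beyond any large point, by a fixed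
multiple of its value there. -/
theorem RegularlyVarying.exists_le_mul_of_neg {f : ℝ → ℝ} {ρ : ℝ} (hm : Measurable f)
    (hf0 : ∀ t, 0 ≤ f t) (hf : RegularlyVarying f ρ) (hρ : ρ < 0) :
    ∃ C t₀, 0 < C ∧ ∀ t, t₀ ≤ t → ∀ v, 1 ≤ v → f (t * v) ≤ C * f t := by
  obtain ⟨C, t₀, hC0, hC⟩ := hf.exists_le_mul hm hf0 2
  have h2 := (hf 2 two_pos).eventually
    (gt_mem_nhds (Real.rpow_lt_one_of_one_lt_of_neg one_lt_two hρ))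
  obtain ⟨t₁, ht₁⟩ := eventually_atTop.1 (h2.and hf.eventually_ne_zero)
  have hstep : ∀ t, t₁ ≤ t → f (t * 2) ≤ f t := fun t ht => by
    have := (ht₁ t ht).1
    rw [div_lt_one (lt_of_le_of_ne (hf0 t) (ht₁ t ht).2.symm)] at this
    exact this.le
  refine ⟨C, max (max t₀ t₁) 1, hC0, fun t ht v hv => ?_⟩
  have ht0 : t₀ ≤ t := (le_max_left _ _).trans ((le_max_left _ _).trans ht)
  have ht1 : t₁ ≤ t := (le_max_right _ _).trans ((le_max_left _ _).trans ht)
  have hpos : 1 ≤ t := (le_max_right _ _).trans ht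
  have hpow : ∀ m : ℕ, f (t * 2 ^ m) ≤ f t := by
    intro m
    induction m with
    | zero => simp
    | succ m ih =>
      rw [pow_succ, ← mul_assoc]
      refine (hstep _ (ht1.trans ?_)).trans ih
      exact le_mul_of_one_le_right (by linarith) (one_le_pow₀ one_le_two)
  -- Since `2 ^ ρ < 1`, doublings eventually do not increase `f`. The remaining factor `v / 2 ^ m`
  -- lies in `[1, 2)` and is covered by the local bound.
  obtain ⟨m, hm1, hm2⟩ := exists_nat_pow_near hv one_lt_two
  have e : t * v = t * 2 ^ m * (v / 2 ^ m) := by field_simp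
  rw [e]
  refine (hC _ (ht0.trans ?_) _ ?_ ?_).trans (mul_le_mul_of_nonneg_left (hpow m) hC0.le)
  · exact le_mul_of_one_le_right (by linarith) (one_le_pow₀ one_le_two)
  · rwa [one_le_div (by positivity)]
  · rw [div_le_iff₀ (by positivity)]
    rw [pow_succ] at hm2; linarith

/-! ### The function `(y ^ c - 1) / c` -/

/-- `(y ^ c - 1) / c`, read as `log y` if `c = 0`. -/
noncomputable def boxCox (c y : ℝ) : ℝ := if c = 0 then Real.log y else (y ^ c - 1) / c

theorem boxCox_one (c : ℝ) : boxCox c 1 = 0 := by simp [boxCox]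

theorem gpTailQuantile_inv {c y : ℝ} (hy : 0 < y) : gpTailQuantile c y⁻¹ = boxCox c y := by
  unfold gpTailQuantile boxCox
  rw [Real.log_inv, neg_neg, Real.inv_rpow hy.le, Real.rpow_neg hy.le, inv_inv]

theorem hasDerivAt_boxCox (c : ℝ) {y : ℝ} (hy : 0 < y) :
    HasDerivAt (boxCox c) (y ^ (c - 1)) y := by
  by_cases hc : c = 0
  · have : boxCox c = Real.log := by ext z; simp [boxCox, hc]
    rw [this, hc, zero_sub, Real.rpow_neg_one]
    exact Real.hasDerivAt_log hy.ne'
  · have : boxCox c = fun z => (z ^ c - 1) / c := by ext z; simp [boxCox, hc]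
    rw [this]
    convert! ((Real.hasDerivAt_rpow_const (p := c) (Or.inl hy.ne')).sub_const 1).div_const c using 1
    field_simp

theorem boxCox_monotoneOn (c : ℝ) : MonotoneOn (boxCox c) (Set.Ici 1) := by
  refine monotoneOn_of_deriv_nonneg (convex_Ici 1) (fun y hy => ?_) (fun y hy => ?_) fun y hy => ?_
  · exact (hasDerivAt_boxCox c (one_pos.trans_le hy)).continuousAt.continuousWithinAt
  · rw [interior_Ici] at hy
    exact (hasDerivAt_boxCox c (one_pos.trans hy)).differentiableAt.differentiableWithinAt
  · rw [interior_Ici] at hy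
    rw [(hasDerivAt_boxCox c (one_pos.trans hy)).deriv]
    exact (Real.rpow_pos_of_pos (one_pos.trans hy) _).le

theorem boxCox_nonneg (c : ℝ) {y : ℝ} (hy : 1 ≤ y) : 0 ≤ boxCox c y :=
  boxCox_one c ▸ boxCox_monotoneOn c (Set.mem_Ici.2 le_rfl) hy hy

theorem boxCox_pos (c : ℝ) {y : ℝ} (hy : 1 < y) : 0 < boxCox c y := by
  unfold boxCox
  split_ifs with h
  · exact Real.log_pos hy
  · rcases lt_or_gt_of_ne h with h | h
    · exact div_pos_of_neg_of_neg (by linarith [Real.rpow_lt_one_of_one_lt_of_neg hy h]) h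
    · exact div_pos (by linarith [Real.one_lt_rpow hy h]) h

/-! ### Tail functions of von Mises type -/

/-- `U` has, from `T` on, a positive derivative `D` whose logarithmic derivative at `t` is
`(γ - 1 + A t) / t`. -/
structure VonMisesTail (U D A : ℝ → ℝ) (γ T : ℝ) : Prop where
  pos : 0 < T
  deriv_pos : ∀ t, T ≤ t → 0 < D t
  hasDerivAt : ∀ t, T ≤ t → HasDerivAt U (D t) t
  hasDerivAt_deriv : ∀ t, T ≤ t → HasDerivAt D ((γ - 1 + A t) * D t / t) t

namespace VonMisesTail

variable {U D A : ℝ → ℝ} {γ T : ℝ}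

/-- The logarithmic derivative in `v` is `(γ - 1 + A (t v) - c) / v`, so a one-sided bound of `γ - 1
+ A` by `c` makes this product monotone. This yields power bounds on `D` without integrating. -/
theorem hasDerivAt_mul_rpow (h : VonMisesTail U D A γ T) {t v : ℝ} (c : ℝ) (ht : T ≤ t)
    (hv : 1 ≤ v) : HasDerivAt (fun v => D (t * v) * v ^ (-c))
      ((γ - 1 + A (t * v) - c) * (D (t * v) * v ^ (-c) / v)) v := by
  have ht0 := h.pos.trans_le ht
  have hv0 : 0 < v := by linarith
  have h1 : HasDerivAt (fun v => t * v) t v := by simpa using (hasDerivAt_id v).const_mul t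
  have h2 := (h.hasDerivAt_deriv (t * v)
    (ht.trans (le_mul_of_one_le_right ht0.le hv))).comp v h1
  convert! h2.mul (Real.hasDerivAt_rpow_const (p := -c) (Or.inl hv0.ne')) using 1
  simp only [Function.comp]
  rw [Real.rpow_sub_one hv0.ne']
  field_simp
  ring

theorem deriv_le (h : VonMisesTail U D A γ T) {t y c : ℝ} (ht : T ≤ t)
    (hA : ∀ v, 1 ≤ v → v ≤ y → γ - 1 + A (t * v) ≤ c) {v : ℝ} (hv : 1 ≤ v) (hvy : v ≤ y) :
    D (t * v) ≤ D t * v ^ c := by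
  have ht0 := h.pos.trans_le ht
  have hanti : AntitoneOn (fun v => D (t * v) * v ^ (-c)) (Set.Icc 1 y) := by
    refine antitoneOn_of_deriv_nonpos (convex_Icc 1 y)
      (fun w hw => (h.hasDerivAt_mul_rpow c ht hw.1).continuousAt.continuousWithinAt)
      (fun w hw => ?_) fun w hw => ?_
    · rw [interior_Icc] at hw
      exact (h.hasDerivAt_mul_rpow c ht hw.1.le).differentiableAt.differentiableWithinAt
    · rw [interior_Icc] at hw
      rw [(h.hasDerivAt_mul_rpow c ht hw.1.le).deriv]
      have hw0 : 0 < w := by linarith [hw.1]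
      have := h.deriv_pos (t * w) (ht.trans (le_mul_of_one_le_right ht0.le hw.1.le))
      exact mul_nonpos_of_nonpos_of_nonneg (by linarith [hA w hw.1.le hw.2.le]) (by positivity)
  have h1 := hanti ⟨le_rfl, hv.trans hvy⟩ ⟨hv, hvy⟩ hv
  have hv0 : 0 < v := by linarith
  simp only [mul_one, Real.one_rpow, Real.rpow_neg hv0.le] at h1
  rwa [← div_eq_mul_inv, div_le_iff₀ (by positivity)] at h1

theorem le_deriv (h : VonMisesTail U D A γ T) {t y c : ℝ} (ht : T ≤ t)
    (hA : ∀ v, 1 ≤ v → v ≤ y → c ≤ γ - 1 + A (t * v)) {v : ℝ} (hv : 1 ≤ v) (hvy : v ≤ y) :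
    D t * v ^ c ≤ D (t * v) := by
  have ht0 := h.pos.trans_le ht
  have hmono : MonotoneOn (fun v => D (t * v) * v ^ (-c)) (Set.Icc 1 y) := by
    refine monotoneOn_of_deriv_nonneg (convex_Icc 1 y)
      (fun w hw => (h.hasDerivAt_mul_rpow c ht hw.1).continuousAt.continuousWithinAt)
      (fun w hw => ?_) fun w hw => ?_
    · rw [interior_Icc] at hw
      exact (h.hasDerivAt_mul_rpow c ht hw.1.le).differentiableAt.differentiableWithinAt
    · rw [interior_Icc] at hw
      rw [(h.hasDerivAt_mul_rpow c ht hw.1.le).deriv]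
      have hw0 : 0 < w := by linarith [hw.1]
      have := h.deriv_pos (t * w) (ht.trans (le_mul_of_one_le_right ht0.le hw.1.le))
      exact mul_nonneg (by linarith [hA w hw.1.le hw.2.le]) (by positivity)
  have h1 := hmono ⟨le_rfl, hv.trans hvy⟩ ⟨hv, hvy⟩ hv
  have hv0 : 0 < v := by linarith
  simp only [mul_one, Real.one_rpow, Real.rpow_neg hv0.le] at h1
  rwa [← div_eq_mul_inv, le_div_iff₀ (by positivity)] at h1

/-- `boxCox c` is the primitive of `v ^ (c - 1)` vanishing at 1, so a power bound on `D` gives this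
difference a monotone sign and passes to increments of `U`. -/
theorem hasDerivAt_sub (h : VonMisesTail U D A γ T) {t v : ℝ} (K c : ℝ) (ht : T ≤ t)
    (hv : 1 ≤ v) : HasDerivAt (fun v => t * K * boxCox c v - U (t * v))
      (t * (K * v ^ (c - 1) - D (t * v))) v := by
  have ht0 := h.pos.trans_le ht
  have h1 : HasDerivAt (fun v => t * v) t v := by simpa using (hasDerivAt_id v).const_mul t
  have h2 := (h.hasDerivAt (t * v) (ht.trans (le_mul_of_one_le_right ht0.le hv))).comp v h1
  convert! ((hasDerivAt_boxCox c (by linarith : 0 < v)).const_mul (t * K)).sub h2 using 1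
  ring

theorem increment_le (h : VonMisesTail U D A γ T) {t y c K : ℝ} (ht : T ≤ t) (hy : 1 ≤ y)
    (hD : ∀ v, 1 ≤ v → v ≤ y → D (t * v) ≤ K * v ^ (c - 1)) :
    U (t * y) - U t ≤ t * K * boxCox c y := by
  have ht0 := h.pos.trans_le ht
  have hmono : MonotoneOn (fun v => t * K * boxCox c v - U (t * v)) (Set.Icc 1 y) := by
    refine monotoneOn_of_deriv_nonneg (convex_Icc 1 y)
      (fun w hw => (h.hasDerivAt_sub K c ht hw.1).continuousAt.continuousWithinAt)
      (fun w hw => ?_) fun w hw => ?_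
    · rw [interior_Icc] at hw
      exact (h.hasDerivAt_sub K c ht hw.1.le).differentiableAt.differentiableWithinAt
    · rw [interior_Icc] at hw
      rw [(h.hasDerivAt_sub K c ht hw.1.le).deriv]
      exact mul_nonneg ht0.le (by linarith [hD w hw.1.le hw.2.le])
  have h1 := hmono ⟨le_rfl, hy⟩ ⟨hy, le_rfl⟩ hy
  simp only [boxCox_one, mul_one, mul_zero] at h1
  linarith

theorem le_increment (h : VonMisesTail U D A γ T) {t y c K : ℝ} (ht : T ≤ t) (hy : 1 ≤ y)
    (hD : ∀ v, 1 ≤ v → v ≤ y → K * v ^ (c - 1) ≤ D (t * v)) :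
    t * K * boxCox c y ≤ U (t * y) - U t := by
  have ht0 := h.pos.trans_le ht
  have hanti : AntitoneOn (fun v => t * K * boxCox c v - U (t * v)) (Set.Icc 1 y) := by
    refine antitoneOn_of_deriv_nonpos (convex_Icc 1 y)
      (fun w hw => (h.hasDerivAt_sub K c ht hw.1).continuousAt.continuousWithinAt)
      (fun w hw => ?_) fun w hw => ?_
    · rw [interior_Icc] at hw
      exact (h.hasDerivAt_sub K c ht hw.1.le).differentiableAt.differentiableWithinAt
    · rw [interior_Icc] at hw
      rw [(h.hasDerivAt_sub K c ht hw.1.le).deriv]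
      exact mul_nonpos_of_nonneg_of_nonpos ht0.le (by linarith [hD w hw.1.le hw.2.le])
  have h1 := hanti ⟨le_rfl, hy⟩ ⟨hy, le_rfl⟩ hy
  simp only [boxCox_one, mul_one, mul_zero] at h1
  linarith

/-- Bounds for the normalized increment of `U` when `|A| ≤ η` between the two points. -/
theorem increment_bounds (h : VonMisesTail U D A γ T) {t y η : ℝ} (ht : T ≤ t) (hy : 1 ≤ y)
    (hη : 0 ≤ η) (hA : ∀ v, 1 ≤ v → v ≤ y → |A (t * v)| ≤ η) :
    (boxCox (γ - η) y ≤ (U (t * y) - U t) / (t * D t) ∧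
      (U (t * y) - U t) / (t * D t) ≤ boxCox (γ + η) y) ∧
    (y ^ (-η) * boxCox γ y ≤ (U (t * y) - U t) / (t * D t) ∧
      (U (t * y) - U t) / (t * D t) ≤ y ^ η * boxCox γ y) := by
  have hb : 0 < t * D t := mul_pos (h.pos.trans_le ht) (h.deriv_pos t ht)
  have hup : ∀ v, 1 ≤ v → v ≤ y → D (t * v) ≤ D t * v ^ (γ + η - 1) := fun v hv hvy =>
    h.deriv_le ht (fun w hw hwy => by linarith [(abs_le.1 (hA w hw hwy)).2]) hv hvy
  have hlo : ∀ v, 1 ≤ v → v ≤ y → D t * v ^ (γ - η - 1) ≤ D (t * v) := fun v hv hvy =>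
    h.le_deriv ht (fun w hw hwy => by linarith [(abs_le.1 (hA w hw hwy)).1]) hv hvy
  have hD := h.deriv_pos t ht
  refine ⟨⟨?_, ?_⟩, ?_, ?_⟩
  · rw [le_div_iff₀ hb, mul_comm]
    exact h.le_increment ht hy hlo
  · rw [div_le_iff₀ hb, mul_comm (boxCox _ _)]
    exact h.increment_le ht hy hup
  -- The second pair of bounds freezes the factors `v ^ (∓η)` at `v = y`, keeping `boxCox γ` itself.
  · rw [le_div_iff₀ hb]
    have := h.le_increment ht hy (c := γ) (K := D t * y ^ (-η)) fun v hv hvy => ?_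
    · linarith
    · refine le_trans ?_ (hlo v hv hvy)
      rw [show γ - η - 1 = -η + (γ - 1) by ring, Real.rpow_add (by linarith), ← mul_assoc]
      have := Real.rpow_le_rpow_of_nonpos (by linarith) hvy (neg_nonpos.2 hη)
      gcongr
  · rw [div_le_iff₀ hb]
    have := h.increment_le ht hy (c := γ) (K := D t * y ^ η) fun v hv hvy => ?_
    · linarith
    · refine (hup v hv hvy).trans ?_
      rw [show γ + η - 1 = η + (γ - 1) by ring, Real.rpow_add (by linarith), ← mul_assoc]
      gcongr

theorem strictMonoOn (h : VonMisesTail U D A γ T) : StrictMonoOn U (Set.Ici T) := by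
  refine strictMonoOn_of_deriv_pos (convex_Ici T)
    (fun t ht => (h.hasDerivAt t ht).continuousAt.continuousWithinAt) fun t ht => ?_
  rw [interior_Ici] at ht
  rw [(h.hasDerivAt t ht.le).deriv]
  exact h.deriv_pos t ht.le

/-- Local Lipschitz bound for `U` on the scale `t * D t`. -/
theorem abs_increment_le (h : VonMisesTail U D A γ T) {t y : ℝ} (ht : 2 * T ≤ t)
    (hA : ∀ s, T ≤ s → |A s| ≤ 1) (hy : 1 / 2 ≤ y) (hy2 : y ≤ 2) :
    |U (t * y) - U t| ≤ t * D t * 2 ^ (|γ| + 2) * |y - 1| := by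
  have hT := h.pos
  have ht0 : 0 < t := by linarith
  have hcb : ∀ v : ℝ, v ≤ 2 → 1 ≤ v → v ^ |γ| ≤ 2 ^ (|γ| + 2) := fun v hv hv1 =>
    (Real.rpow_le_rpow (by linarith) hv (abs_nonneg γ)).trans
      (Real.rpow_le_rpow_of_exponent_le one_le_two (by linarith))
  have hD : ∀ v ∈ Set.Icc (1 / 2 : ℝ) 2, D (t * v) ≤ D t * 2 ^ (|γ| + 2) := by
    intro v hv
    have hDt := h.deriv_pos t (by linarith)
    rcases le_total 1 v with hv1 | hv1
    · refine (h.deriv_le (y := 2) (c := |γ|) (by linarith) (fun w hw _ => ?_) hv1 hv.2).trans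
        (mul_le_mul_of_nonneg_left (hcb v hv.2 hv1) hDt.le)
      have := (abs_le.1 (hA (t * w) (by nlinarith))).2
      linarith [le_abs_self γ]
    -- For `v ≤ 1` the comparison runs upwards from `t v` to `t`. As `|A| ≤ 1`, the exponent `γ - 1
    -- + A` is at least `-(|γ| + 2)`.
    · have hv0 : 0 < v := by linarith [hv.1]
      have hTv : T ≤ t * v := by nlinarith [hv.1]
      have h1 := h.le_deriv (t := t * v) (y := v⁻¹) (c := -(|γ| + 2)) hTv (fun w hw _ => ?_)
        ((one_le_inv₀ hv0).2 hv1) le_rfl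
      · rw [mul_assoc, mul_inv_cancel₀ hv0.ne', mul_one, Real.inv_rpow hv0.le,
          Real.rpow_neg hv0.le, inv_inv] at h1
        have h2 : (1 / 2 : ℝ) ^ (|γ| + 2) ≤ v ^ (|γ| + 2) :=
          Real.rpow_le_rpow (by norm_num) hv.1 (by positivity)
        rw [one_div, Real.inv_rpow zero_le_two] at h2
        have h3 := (mul_le_mul_of_nonneg_left h2 (h.deriv_pos _ hTv).le).trans h1
        rwa [← div_eq_mul_inv, div_le_iff₀ (by positivity)] at h3
      · have := (abs_le.1 (hA (t * v * w) (by nlinarith))).1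
        linarith [neg_abs_le γ]
  have hd : ∀ v ∈ Set.Icc (1 / 2 : ℝ) 2,
      HasDerivWithinAt (fun v => U (t * v)) (D (t * v) * t) (Set.Icc (1 / 2) 2) v := by
    intro v hv
    have h1 : HasDerivAt (fun v => t * v) t v := by simpa using (hasDerivAt_id v).const_mul t
    exact ((h.hasDerivAt (t * v) (by nlinarith [hv.1])).comp v h1).hasDerivWithinAt
  have := (convex_Icc (1 / 2 : ℝ) 2).norm_image_sub_le_of_norm_hasDerivWithin_le
    (C := t * D t * 2 ^ (|γ| + 2)) hd (fun v hv => ?_) (x := 1) (y := y)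
    ⟨by norm_num, by norm_num⟩ ⟨hy, hy2⟩
  · simpa [Real.norm_eq_abs] using this
  · rw [Real.norm_eq_abs, abs_of_nonneg]
    · calc D (t * v) * t ≤ D t * 2 ^ (|γ| + 2) * t := by gcongr; exact hD v hv
        _ = _ := by ring
    · exact mul_nonneg (h.deriv_pos _ (by nlinarith [hv.1])).le ht0.le

end VonMisesTail

/-! ### Elementary inequalities -/

theorem abs_log_one_add_sub_le {x : ℝ} (hx : |x| ≤ 1 / 2) : |Real.log (1 + x) - x| ≤ 2 * x ^ 2 := by
  have h := abs_le.1 hx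
  have h0 : 0 < 1 + x := by linarith [h.1]
  have h1 := Real.log_le_sub_one_of_pos h0
  have h2 := Real.one_sub_inv_le_log_of_pos h0
  have h3 : 1 - (1 + x)⁻¹ - x + 2 * x ^ 2 = x ^ 2 * (1 + 2 * x) / (1 + x) := by field_simp; ring
  have h4 : 0 ≤ x ^ 2 * (1 + 2 * x) / (1 + x) :=
    div_nonneg (mul_nonneg (sq_nonneg x) (by linarith [h.1])) h0.le
  rw [abs_le]
  constructor <;> nlinarith [sq_nonneg x]

theorem abs_log_one_add_le {x : ℝ} (hx : |x| ≤ 1 / 2) : |Real.log (1 + x)| ≤ 2 * |x| := by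
  have h := abs_le.1 hx
  have h0 : 0 < 1 + x := by linarith [h.1]
  have h1 := Real.log_le_sub_one_of_pos h0
  have h2 := Real.one_sub_inv_le_log_of_pos h0
  have h3 : 1 - (1 + x)⁻¹ = x / (1 + x) := by field_simp; ring
  have h4 : -(2 * |x|) ≤ x / (1 + x) := by
    rw [le_div_iff₀ h0]
    nlinarith [neg_abs_le x, abs_nonneg x]
  rw [abs_le]
  constructor <;> linarith [le_abs_self x, abs_nonneg x]

theorem abs_exp_sub_one_le_two_mul {x e : ℝ} (hx : |x| ≤ e) (he : e ≤ 1) :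
    |Real.exp x - 1| ≤ 2 * e :=
  (Real.abs_exp_sub_one_le (hx.trans he)).trans (by linarith)

theorem weight_nonneg (γ : ℝ) {y : ℝ} (hy : 1 ≤ y) : 0 ≤ weight γ y := by
  unfold weight
  split_ifs
  · exact Real.log_nonneg hy
  · positivity
  · positivity

theorem one_le_weight_of_neg {γ : ℝ} (hγ : γ < 0) {y : ℝ} (hy : 1 ≤ y) : 1 ≤ weight γ y := by
  rw [weight, if_neg (by linarith), if_neg hγ.ne]
  exact Real.one_le_rpow hy (by linarith)

theorem weight_monotoneOn (γ : ℝ) : MonotoneOn (weight γ) (Set.Ici 1) := by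
  intro x hx y hy hxy
  have hx0 : 0 < x := one_pos.trans_le hx
  unfold weight
  split_ifs with h h'
  · exact Real.log_le_log hx0 hxy
  · have := Real.log_le_log hx0 hxy
    have := Real.log_nonneg hx
    gcongr
  · exact Real.rpow_le_rpow hx0.le hxy (by linarith)

theorem weight_pos {γ y : ℝ} (hy : 1 < y) : 0 < weight γ y := by
  have := Real.log_pos hy
  unfold weight
  split_ifs <;> positivity

theorem exists_log_le (γ : ℝ) : ∃ C, 0 < C ∧ ∀ y, 1 ≤ y → Real.log y ≤ C * (1 + weight γ y) := by
  rcases lt_trichotomy γ 0 with h | h | h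
  · refine ⟨1 / -γ, by simpa using h, fun y hy => ?_⟩
    rw [weight, if_neg (by linarith), if_neg h.ne]
    have h1 := Real.log_le_rpow_div (by linarith : 0 ≤ y) (neg_pos.2 h)
    have h2 : 0 < 1 / -γ := by simpa using h
    rw [div_eq_mul_one_div, mul_comm] at h1
    nlinarith
  · refine ⟨1, one_pos, fun y hy => ?_⟩
    rw [weight, if_neg (by linarith), if_pos h]
    nlinarith [sq_nonneg (Real.log y - 1), sq_nonneg (Real.log y)]
  · refine ⟨1, one_pos, fun y hy => ?_⟩
    rw [weight, if_pos h]
    linarith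

/-- This lets absolute errors of size `δ` be absorbed into the scale `δ * (y ^ γ * (1 + weight γ
y))`. -/
theorem one_le_rpow_mul_weight (γ : ℝ) {y : ℝ} (hy : 1 ≤ y) : 1 ≤ y ^ γ * (1 + weight γ y) := by
  have hw := weight_nonneg γ hy
  rcases lt_or_ge γ 0 with h | h
  · rw [weight, if_neg (by linarith), if_neg h.ne, mul_add, ← Real.rpow_add (by linarith)]
    simp only [mul_one, add_neg_cancel, Real.rpow_zero]
    have : 0 ≤ y ^ γ := by positivity
    linarith
  · have := Real.one_le_rpow hy h
    nlinarith

theorem one_add_mul_boxCox {γ : ℝ} (hγ : γ ≠ 0) (y : ℝ) : 1 + γ * boxCox γ y = y ^ γ := by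
  rw [boxCox, if_neg hγ]
  field_simp
  ring

theorem exists_boxCox_le (γ : ℝ) :
    ∃ C, 0 < C ∧ ∀ y, 1 ≤ y → boxCox γ y ≤ C * (y ^ γ * (1 + weight γ y)) := by
  rcases lt_trichotomy γ 0 with h | h | h
  · refine ⟨1 / -γ, by simpa using h, fun y hy => ?_⟩
    have h1 := one_le_rpow_mul_weight γ hy
    have h2 : 0 < 1 / -γ := by simpa using h
    have h3 : boxCox γ y ≤ 1 / -γ := by
      have : 0 ≤ y ^ γ := by positivity
      rw [boxCox, if_neg h.ne, ← neg_div_neg_eq]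
      exact div_le_div_of_nonneg_right (by linarith) (by linarith)
    nlinarith
  · obtain ⟨C, hC, hl⟩ := exists_log_le γ
    refine ⟨C, hC, fun y hy => ?_⟩
    have := hl y hy
    rwa [boxCox, if_pos h, h, Real.rpow_zero, one_mul, ← h]
  · refine ⟨1 / γ, by positivity, fun y hy => ?_⟩
    have hw := weight_nonneg γ hy
    have : 0 ≤ y ^ γ := by positivity
    rw [boxCox, if_neg h.ne', div_eq_mul_one_div, mul_comm]
    gcongr
    nlinarith

/-! ### Perturbation of normalized increments -/

theorem abs_sub_boxCox_le_log {γ η y z : ℝ} (hy : 1 ≤ y) (hη : 0 ≤ η) (hsmall : η * Real.log y ≤ 1)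
    (hlo : y ^ (-η) * boxCox γ y ≤ z) (hup : z ≤ y ^ η * boxCox γ y) :
    |z - boxCox γ y| ≤ 2 * (η * Real.log y) * boxCox γ y := by
  have hb := boxCox_nonneg γ hy
  have hx : 0 ≤ η * Real.log y := mul_nonneg hη (Real.log_nonneg hy)
  have e1 : y ^ η = Real.exp (η * Real.log y) := by
    rw [Real.rpow_def_of_pos (by linarith), mul_comm]
  have e2 : y ^ (-η) = Real.exp (-(η * Real.log y)) := by
    rw [Real.rpow_def_of_pos (by linarith)]; congr 1; ring
  have h1 := (abs_le.1 (abs_exp_sub_one_le_two_mul (abs_of_nonneg hx).le hsmall)).2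
  have h2 := Real.add_one_le_exp (-(η * Real.log y))
  rw [e1] at hup
  rw [e2] at hlo
  rw [abs_le]
  constructor <;> nlinarith

/-- For `γ ≥ 0` the relative error `η log y` from the multiplicative bounds is affordable. For `γ <
0` the allowed scale `y ^ γ * (1 + weight γ y) = 1 + y ^ γ` is bounded and leaves no room for a
logarithm. There the bounds with shifted exponent are used, since only the denominators `γ ± η` then
cost anything. -/
theorem exists_abs_sub_boxCox_le (γ : ℝ) : ∃ C c, 0 < C ∧ 0 < c ∧ ∀ η y z, 0 ≤ η → 1 ≤ y →
    η * (1 + weight γ y) ≤ c →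
    (boxCox (γ - η) y ≤ z ∧ z ≤ boxCox (γ + η) y) →
    (y ^ (-η) * boxCox γ y ≤ z ∧ z ≤ y ^ η * boxCox γ y) →
    |z - boxCox γ y| ≤ C * (η * (y ^ γ * (1 + weight γ y))) := by
  rcases lt_trichotomy γ 0 with h | h | h
  · have hsq : 0 < γ ^ 2 := sq_pos_of_neg h
    refine ⟨2 / γ ^ 2, -γ / 2, by positivity, by linarith, fun η y z hη hy hs hz _ => ?_⟩
    have hw := weight_nonneg γ hy
    -- This keeps `γ + η ≤ γ / 2`, so the shifted exponents stay negative and bounded away from 0.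
    have hηγ : η ≤ -γ / 2 := by nlinarith
    have h1 := one_le_rpow_mul_weight γ hy
    have hpow : ∀ c : ℝ, c ≤ 0 → y ^ c ≤ 1 := fun c hc => Real.rpow_le_one_of_one_le_of_nonpos hy hc
    have hp0 : ∀ c : ℝ, 0 ≤ y ^ c := fun c => Real.rpow_nonneg (by linarith) c
    suffices hs : |z - boxCox γ y| ≤ 2 / γ ^ 2 * η by
      refine hs.trans ?_
      gcongr
      nlinarith
    have e : ∀ c, c < 0 → boxCox c y = (1 - y ^ c) / (-c) := fun c hc => by
      rw [boxCox, if_neg hc.ne, ← neg_div_neg_eq]; congr 1; ring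
    rw [e _ (by linarith), e _ (by linarith)] at hz
    rw [e _ h, abs_le]
    constructor
    · have h2 : y ^ (γ - η) ≤ y ^ γ := Real.rpow_le_rpow_of_exponent_le hy (by linarith)
      have h3 : (1 - y ^ γ) / (-(γ - η)) ≤ z := by
        refine le_trans ?_ hz.1
        gcongr
        linarith
      have h4 : (1 - y ^ γ) / -γ - (1 - y ^ γ) / (-(γ - η))
          = (1 - y ^ γ) * (η / (γ * (γ - η))) := by
        have : γ - η ≠ 0 := by linarith
        have := h.ne
        field_simp
        ring
      have h5 : η / (γ * (γ - η)) ≤ 2 / γ ^ 2 * η := by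
        rw [div_mul_eq_mul_div, div_le_div_iff₀ (mul_pos_of_neg_of_neg h (by linarith)) hsq]
        nlinarith [mul_nonneg hη hη, mul_nonneg hη hsq.le]
      have h6 : 0 ≤ 2 / γ ^ 2 * η := by positivity
      nlinarith [hpow γ h.le, hp0 γ]
    · have h2 : y ^ γ ≤ y ^ (γ + η) := Real.rpow_le_rpow_of_exponent_le hy (by linarith)
      have h3 : z ≤ (1 - y ^ γ) / (-(γ + η)) := by
        refine hz.2.trans ?_
        gcongr
        linarith
      have h4 : (1 - y ^ γ) / (-(γ + η)) - (1 - y ^ γ) / -γ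
          = (1 - y ^ γ) * (η / (γ * (γ + η))) := by
        have : γ + η ≠ 0 := by linarith
        have := h.ne
        field_simp
        ring
      have h5 : η / (γ * (γ + η)) ≤ 2 / γ ^ 2 * η := by
        rw [div_mul_eq_mul_div, div_le_div_iff₀ (mul_pos_of_neg_of_neg h (by linarith)) hsq]
        nlinarith [mul_nonneg hη (by nlinarith : 0 ≤ γ * (γ + 2 * η))]
      have h6 : 0 ≤ 2 / γ ^ 2 * η := by positivity
      nlinarith [hpow γ h.le, hp0 γ]
  · obtain ⟨C, hC, hl⟩ := exists_log_le γ
    refine ⟨2, 1 / C, two_pos, by positivity, fun η y z hη hy hs _ hz => ?_⟩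
    have hsm : η * Real.log y ≤ 1 := by
      rw [le_div_iff₀ hC] at hs
      nlinarith [mul_le_mul_of_nonneg_left (hl y hy) hη]
    refine (abs_sub_boxCox_le_log hy hη hsm hz.1 hz.2).trans ?_
    rw [boxCox, if_pos h, weight, if_neg (by linarith), if_pos h, h, Real.rpow_zero]
    nlinarith
  · obtain ⟨C, hC, hl⟩ := exists_log_le γ
    refine ⟨2 / γ, 1 / C, by positivity, by positivity, fun η y z hη hy hs _ hz => ?_⟩
    have hsm : η * Real.log y ≤ 1 := by
      rw [le_div_iff₀ hC] at hs
      nlinarith [mul_le_mul_of_nonneg_left (hl y hy) hη]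
    refine (abs_sub_boxCox_le_log hy hη hsm hz.1 hz.2).trans ?_
    have hlog := Real.log_nonneg hy
    have hp : 0 ≤ y ^ γ := by positivity
    rw [boxCox, if_neg h.ne', weight, if_pos h]
    have : 2 * (η * Real.log y) * ((y ^ γ - 1) / γ)
        = 2 / γ * (η * ((y ^ γ - 1) * Real.log y)) := by field_simp
    rw [this]
    gcongr <;> linarith

/-! ### Perturbation of generalized Pareto tails -/

/-- Minus the logarithm of the generalized Pareto tail function. -/
noncomputable def gpNegLogTail (g z : ℝ) : ℝ := if g = 0 then z else Real.log (1 + g * z) / g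

theorem one_sub_gpStd_of_pos {g z : ℝ} (hz : 0 < z) (h : 0 < 1 + g * z) :
    1 - gpStd g z = Real.exp (-gpNegLogTail g z) := by
  rw [gpStd, if_neg hz.not_ge, gpNegLogTail]
  split_ifs with hg
  · ring
  · rw [max_eq_right h.le, Real.rpow_def_of_pos h]
    rw [sub_sub_cancel]
    congr 1
    ring

theorem gpNegLogTail_nonpos {g z : ℝ} (hz : z ≤ 0) (h : 0 < 1 + g * z) : gpNegLogTail g z ≤ 0 := by
  rw [gpNegLogTail]
  split_ifs with hg
  · exact hz
  · rcases lt_or_gt_of_ne hg with hg | hg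
    · exact div_nonpos_of_nonneg_of_nonpos (Real.log_nonneg (by nlinarith)) hg.le
    · exact div_nonpos_of_nonpos_of_nonneg (Real.log_nonpos h.le (by nlinarith)) hg.le

theorem abs_mul_one_sub_gpStd_sub_one_le {g z y e : ℝ} (hy : 1 ≤ y) (h : 0 < 1 + g * z)
    (hL : |Real.log y - gpNegLogTail g z| ≤ e) (he : e ≤ 1) :
    |y * (1 - gpStd g z) - 1| ≤ 2 * e := by
  have hy0 : 0 < y := by linarith
  -- If `z ≤ 0` the estimated tail is truncated to 1, and the ratio is `y` itself. The untruncated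
  -- minus-log-tail is then nonpositive, so the hypothesis forces `log y ≤ e`.
  rcases le_or_gt z 0 with hz | hz
  · rw [gpStd, if_pos hz, sub_zero, mul_one]
    have h1 := gpNegLogTail_nonpos hz h
    have h2 := Real.log_nonneg hy
    have := abs_exp_sub_one_le_two_mul (x := Real.log y) (e := e)
      (by rw [abs_of_nonneg h2]; linarith [le_abs_self (Real.log y - gpNegLogTail g z)]) he
    rwa [Real.exp_log hy0] at this
  · rw [one_sub_gpStd_of_pos hz h]
    have := abs_exp_sub_one_le_two_mul hL he
    rwa [sub_eq_add_neg (Real.log y), Real.exp_add, Real.exp_log hy0] at this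

theorem exists_abs_log_sub_le_of_ne_zero {γ : ℝ} (hγ : γ ≠ 0) {C₀ : ℝ} (hC₀ : 0 < C₀) :
    ∃ C c, 0 < C ∧ 0 < c ∧ ∀ δ y g z, 0 ≤ δ → 1 ≤ y → δ * (1 + weight γ y) ≤ c →
      |g - γ| ≤ C₀ * δ → |z - boxCox γ y| ≤ C₀ * (δ * (y ^ γ * (1 + weight γ y))) →
      0 < 1 + g * z ∧ |Real.log y - gpNegLogTail g z| ≤ C * (δ * (1 + weight γ y)) := by
  obtain ⟨Cl, hCl, hl⟩ := exists_log_le γ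
  obtain ⟨Cb, hCb, hb⟩ := exists_boxCox_le γ
  have hγ' : 0 < |γ| := abs_pos.2 hγ
  -- The first term comes from the index error times `boxCox γ y`, the second from `|g| ≤ 2|γ|`
  -- times the argument error. The two smallness thresholds below give `|g - γ| ≤ |γ| / 2` and `|e|
  -- ≤ 1 / 2`.
  set K : ℝ := C₀ * Cb + 2 * |γ| * C₀ with hK
  have hKpos : 0 < K := by positivity
  refine ⟨2 / |γ| * (C₀ * Cl + 2 * K), min (|γ| / (2 * C₀)) (1 / (2 * K)), by positivity,
    by positivity, fun δ y g z hδ hy hs hg hz => ?_⟩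
  have hy0 : 0 < y := by linarith
  have hw := weight_nonneg γ hy
  have hlog := Real.log_nonneg hy
  set W := 1 + weight γ y with hW
  have hW1 : 1 ≤ W := by linarith
  have hp : 0 < y ^ γ := Real.rpow_pos_of_pos hy0 γ
  have hs1 := hs.trans (min_le_left _ _)
  have hs2 := hs.trans (min_le_right _ _)
  rw [le_div_iff₀ (by positivity)] at hs1 hs2
  have hgγ : |g - γ| ≤ |γ| / 2 := by nlinarith [mul_nonneg hδ hw, mul_nonneg hC₀.le hδ]
  have hg_lo : |γ| / 2 ≤ |g| := by
    have := abs_sub_abs_le_abs_sub γ g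
    rw [abs_sub_comm] at this
    linarith
  have hg_up : |g| ≤ 2 * |γ| := by
    have := abs_sub_abs_le_abs_sub g γ
    linarith
  have hg0 : g ≠ 0 := abs_pos.1 (by linarith)
  -- The error is measured relative to the exact value `1 + γ * boxCox γ y = y ^ γ`; taking
  -- logarithms then separates `γ * log y` from `log (1 + e)`.
  obtain ⟨e, he⟩ : ∃ e, 1 + g * z = y ^ γ * (1 + e) :=
    ⟨(1 + g * z) / y ^ γ - 1, by field_simp; ring⟩
  have he_le : |e| ≤ K * (δ * W) := by
    have h1 : y ^ γ * e = (g - γ) * boxCox γ y + g * (z - boxCox γ y) := by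
      have := one_add_mul_boxCox hγ y
      linear_combination he.symm + this
    have h2 : y ^ γ * |e| ≤ y ^ γ * (K * (δ * W)) := by
      rw [← abs_of_pos hp, ← abs_mul, abs_of_pos hp, h1]
      calc |(g - γ) * boxCox γ y + g * (z - boxCox γ y)|
          ≤ |g - γ| * boxCox γ y + |g| * |z - boxCox γ y| := by
            refine (abs_add_le _ _).trans ?_
            rw [abs_mul, abs_mul, abs_of_nonneg (boxCox_nonneg γ hy)]
        _ ≤ (C₀ * δ) * (Cb * (y ^ γ * W)) + 2 * |γ| * (C₀ * (δ * (y ^ γ * W))) := by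
            have := hb y hy
            have := boxCox_nonneg γ hy
            gcongr
        _ = y ^ γ * (K * (δ * W)) := by rw [hK]; ring
    exact le_of_mul_le_mul_left h2 hp
  have he2 : |e| ≤ 1 / 2 := by nlinarith
  have hpos : 0 < 1 + g * z := by
    rw [he]
    exact mul_pos hp (by linarith [(abs_le.1 he2).1])
  refine ⟨hpos, ?_⟩
  have h1e : 0 < 1 + e := by linarith [(abs_le.1 he2).1]
  rw [gpNegLogTail, if_neg hg0, he, Real.log_mul hp.ne' h1e.ne', Real.log_rpow hy0]
  have h3 : Real.log y - (γ * Real.log y + Real.log (1 + e)) / g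
      = ((g - γ) * Real.log y - Real.log (1 + e)) / g := by field_simp; ring
  rw [h3, abs_div, div_le_iff₀ (by linarith)]
  calc |(g - γ) * Real.log y - Real.log (1 + e)|
      ≤ |g - γ| * Real.log y + |Real.log (1 + e)| := by
        refine (abs_sub _ _).trans ?_
        rw [abs_mul, abs_of_nonneg hlog]
    _ ≤ C₀ * δ * (Cl * W) + 2 * (K * (δ * W)) := by
        have h5 := hl y hy
        have h6 := abs_log_one_add_le he2
        gcongr
        linarith
    _ = 2 / |γ| * (C₀ * Cl + 2 * K) * (δ * W) * (|γ| / 2) := by field_simp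
    _ ≤ _ := by gcongr

/-- Expanding, `log (1 + g z) / g = z + O(g z²)` with `z` close to `log y`; the quadratic term is
the origin of the weight `log² y`. -/
theorem exists_abs_log_sub_le_of_eq_zero {C₀ : ℝ} (hC₀ : 0 < C₀) :
    ∃ C c, 0 < C ∧ 0 < c ∧ ∀ δ y g z, 0 ≤ δ → 1 ≤ y → δ * (1 + weight 0 y) ≤ c →
      |g| ≤ C₀ * δ → |z - Real.log y| ≤ C₀ * (δ * (1 + weight 0 y)) →
      0 < 1 + g * z ∧ |Real.log y - gpNegLogTail g z| ≤ C * (δ * (1 + weight 0 y)) := by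
  refine ⟨5 * C₀, 1 / (4 * C₀), by positivity, by positivity, fun δ y g z hδ hy hs hg hz => ?_⟩
  have hlog := Real.log_nonneg hy
  have hw : weight 0 y = Real.log y ^ 2 := by simp [weight]
  rw [hw] at hs hz ⊢
  set l := Real.log y
  rw [le_div_iff₀ (by positivity)] at hs
  have hz1 : |z - l| ≤ 1 / 4 := by nlinarith
  have hzl : |z| ≤ l + 1 / 4 := by
    have := abs_sub_abs_le_abs_sub z l
    rw [abs_of_nonneg hlog] at this
    linarith
  have hgz : |g * z| ≤ 1 / 2 := by
    rw [abs_mul]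
    calc |g| * |z| ≤ (C₀ * δ) * (l + 1 / 4) := by gcongr
      _ ≤ (C₀ * δ) * (2 * (1 + l ^ 2)) := by
        gcongr
        nlinarith [sq_nonneg (l - 1)]
      _ ≤ 1 / 2 := by linarith
  refine ⟨by linarith [(abs_le.1 hgz).1], ?_⟩
  have h1 : |z - gpNegLogTail g z| ≤ 4 * C₀ * (δ * (1 + l ^ 2)) := by
    rw [gpNegLogTail]
    split_ifs with h0
    · rw [sub_self, abs_zero]; positivity
    · have e : z - Real.log (1 + g * z) / g = -((Real.log (1 + g * z) - g * z) / g) := by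
        field_simp; ring
      have hgpos : 0 < |g| := abs_pos.2 h0
      rw [e, abs_neg, abs_div, div_le_iff₀ hgpos]
      refine (abs_log_one_add_sub_le hgz).trans ?_
      have hz2 : z ^ 2 ≤ 2 * (1 + l ^ 2) := by
        rw [← sq_abs z]
        nlinarith [abs_nonneg z, sq_nonneg (l - 1)]
      calc 2 * (g * z) ^ 2 = 2 * |g| * z ^ 2 * |g| := by rw [mul_pow, ← sq_abs g]; ring
        _ ≤ 2 * (C₀ * δ) * (2 * (1 + l ^ 2)) * |g| := by gcongr
        _ = _ := by ring
  have h2 := abs_sub_le l z (gpNegLogTail g z)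
  rw [abs_sub_comm l z] at h2
  linarith

/-- Stability of the generalized Pareto tail at its own quantile under perturbations of the index
and of the argument. -/
theorem exists_abs_gpStd_ratio_sub_one_le (γ : ℝ) {C₀ : ℝ} (hC₀ : 0 < C₀) :
    ∃ C c, 0 < C ∧ 0 < c ∧ ∀ δ y g z, 0 ≤ δ → 1 ≤ y → δ * (1 + weight γ y) ≤ c →
      |g - γ| ≤ C₀ * δ → |z - boxCox γ y| ≤ C₀ * (δ * (y ^ γ * (1 + weight γ y))) →
      |y * (1 - gpStd g z) - 1| ≤ C * (δ * (1 + weight γ y)) := by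
  obtain ⟨C, c, hC, hc, h⟩ : ∃ C c, 0 < C ∧ 0 < c ∧ ∀ δ y g z, 0 ≤ δ → 1 ≤ y →
      δ * (1 + weight γ y) ≤ c →
      |g - γ| ≤ C₀ * δ → |z - boxCox γ y| ≤ C₀ * (δ * (y ^ γ * (1 + weight γ y))) →
      0 < 1 + g * z ∧ |Real.log y - gpNegLogTail g z| ≤ C * (δ * (1 + weight γ y)) := by
    by_cases hγ : γ = 0
    · subst hγ
      obtain ⟨C, c, hC, hc, h⟩ := exists_abs_log_sub_le_of_eq_zero hC₀
      refine ⟨C, c, hC, hc, fun δ y g z hδ hy hs hg hz => h δ y g z hδ hy hs ?_ ?_⟩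
      · simpa using hg
      · simpa [boxCox] using hz
    · exact exists_abs_log_sub_le_of_ne_zero hγ hC₀
  refine ⟨2 * C, min c (1 / C), by positivity, by positivity, fun δ y g z hδ hy hs hg hz => ?_⟩
  obtain ⟨h1, h2⟩ := h δ y g z hδ hy (hs.trans (min_le_left _ _)) hg hz
  refine (abs_mul_one_sub_gpStd_sub_one_le hy h1 h2 ?_).trans_eq (by ring)
  have := hs.trans (min_le_right _ _)
  rw [le_div_iff₀ hC] at this
  linarith

/-! ### Quantile functions -/

section Quantile

variable {P : Measure ℝ}

/-- Right continuity of the distribution function makes the infimum attained, whence the Galois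
connection. -/
theorem quantile_le_iff {p : ℝ} (hp0 : 0 < p) (hp1 : p < 1) (x : ℝ) :
    quantile (cdf P) p ≤ x ↔ p ≤ cdf P x := by
  have hbdd : BddBelow {x : ℝ | 0 < cdf P x ∧ p ≤ cdf P x} := by
    obtain ⟨b, hb⟩ := ((tendsto_cdf_atBot P).eventually (gt_mem_nhds hp0)).exists
    refine ⟨b, fun z hz => ?_⟩
    by_contra! hzb
    linarith [monotone_cdf P hzb.le, hz.2]
  have hne : {x : ℝ | 0 < cdf P x ∧ p ≤ cdf P x}.Nonempty := by
    obtain ⟨b, hb⟩ := ((tendsto_cdf_atTop P).eventually (lt_mem_nhds hp1)).exists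
    exact ⟨b, hp0.trans hb, hb.le⟩
  refine ⟨fun h => ?_, fun h => csInf_le hbdd ⟨hp0.trans_le h, h⟩⟩
  by_contra! hx
  have h1 : Tendsto (cdf P) (𝓝[>] x) (𝓝 (cdf P x)) :=
    ((cdf P).right_continuous x).mono_left (nhdsWithin_mono x Set.Ioi_subset_Ici_self)
  obtain ⟨z, hz, hxz⟩ := ((h1.eventually (gt_mem_nhds hx)).and self_mem_nhdsWithin).exists
  have h2 : z ≤ quantile (cdf P) p := by
    refine le_csInf hne fun w hw => ?_
    by_contra! hwz
    linarith [monotone_cdf P hwz.le, hw.2]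
  exact absurd (h2.trans h) (not_le.2 hxz)

/-- A jump of the distribution function past `p` would make the quantile function constant just
above `p`, against strict monotonicity. -/
theorem cdf_quantile {p₀ p : ℝ} (hp₀ : 0 ≤ p₀)
    (hQ : StrictMonoOn (quantile (cdf P)) (Set.Ioo p₀ 1)) (hp : p ∈ Set.Ioo p₀ 1) :
    cdf P (quantile (cdf P) p) = p := by
  have hp0 : 0 < p := hp₀.trans_lt hp.1
  refine le_antisymm ?_ ((quantile_le_iff hp0 hp.2 _).1 le_rfl)
  by_contra! h
  obtain ⟨r, hr1, hr2⟩ := exists_between (lt_min h hp.2)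
  have hr3 := hr2.trans_le (min_le_right _ _)
  have := hQ hp ⟨hp.1.trans hr1, hr3⟩ hr1
  exact absurd ((quantile_le_iff (hp0.trans hr1) hr3 _).2 (hr2.trans_le (min_le_left _ _)).le)
    (not_le.2 this)

/-- The quantile function of the distribution of exceedances of a high threshold. -/
theorem quantile_exceedance {p₀ p q t : ℝ} (hp₀ : 0 ≤ p₀)
    (hQ : StrictMonoOn (quantile (cdf P)) (Set.Ioo p₀ 1)) (hp : p ∈ Set.Ioo p₀ 1)
    (hQc : ContinuousAt (quantile (cdf P)) p) (ht : cdf P t = p) (hq : 0 ≤ q) :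
    quantile (fun y => max 0 ((cdf P y - cdf P t) / (1 - cdf P t))) q
      = quantile (cdf P) (p + q * (1 - p)) := by
  have hp0 : 0 < p := hp₀.trans_lt hp.1
  have hπ : 0 < 1 - p := by linarith [hp.2]
  have hpos : ∀ y, 0 < max 0 ((cdf P y - p) / (1 - p)) ↔ p < cdf P y := fun y => by
    rw [lt_max_iff, div_pos_iff_of_pos_right hπ, sub_pos]
    simp
  rw [ht]
  rcases hq.eq_or_lt with rfl | hq
  -- Level 0 is needed when `τ* = 1`. The quantile is then the left end-point of the exceedance law,
  -- which equals `Q(p)` because `Q` is continuous at `p`.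
  · rw [zero_mul, add_zero]
    have hset : {x : ℝ | 0 < max 0 ((cdf P x - p) / (1 - p)) ∧
        0 ≤ max 0 ((cdf P x - p) / (1 - p))} = {x | p < cdf P x} := by
      ext y
      simp only [Set.mem_ofPred_eq, hpos]
      exact ⟨fun h => h.1, fun h => ⟨h, le_max_left _ _⟩⟩
    rw [quantile, hset]
    have hlow : ∀ y ∈ {x | p < cdf P x}, quantile (cdf P) p ≤ y := fun y hy =>
      (quantile_le_iff hp0 hp.2 y).2 (le_of_lt hy)
    have hmem : ∀ r ∈ Set.Ioo p 1, quantile (cdf P) r ∈ {x | p < cdf P x} := fun r hr => by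
      simp only [Set.mem_ofPred_eq]
      rw [cdf_quantile hp₀ hQ ⟨hp.1.trans hr.1, hr.2⟩]
      exact hr.1
    refine le_antisymm ?_ (le_csInf ?_ hlow)
    · refine ge_of_tendsto (hQc.mono_left (nhdsWithin_le_nhds (s := Set.Ioi p))) ?_
      filter_upwards [Ioo_mem_nhdsGT hp.2] with r hr
      exact csInf_le ⟨_, hlow⟩ (hmem r hr)
    · obtain ⟨r, hr⟩ := exists_between hp.2
      exact ⟨_, hmem r hr⟩
  · unfold quantile
    congr 1
    ext y
    simp only [Set.mem_ofPred_eq, hpos, le_max_iff, le_div_iff₀ hπ]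
    have : 0 < q * (1 - p) := by positivity
    constructor
    · rintro ⟨h1, h2 | h2⟩
      · linarith
      · exact ⟨by linarith, by linarith⟩
    · rintro ⟨h1, h2⟩
      exact ⟨by linarith, Or.inr (by linarith)⟩

end Quantile

/-! ### The predictive distribution of tail events -/

section Predictive

variable {Ω : Type*} [MeasurableSpace Ω] {μ : Measure Ω} {X : ℕ → Ω → ℝ}

theorem measurable_sample (hX : ∀ i, Measurable (X i)) (n : ℕ) : Measurable (sample X n) :=
  measurable_pi_lambda _ fun i => hX i

theorem indepFun_sample (hX : ∀ i, Measurable (X i)) (hind : iIndepFun X μ) (n : ℕ) :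
    IndepFun (sample X n) (X n) μ := by
  have h := hind.indepFun_finset (Finset.range n) {n} (by simp) hX
  have h1 : Measurable fun (f : Finset.range n → ℝ) (i : Fin n) => f ⟨i, Finset.mem_range.2 i.2⟩ :=
    measurable_pi_lambda _ fun i => measurable_pi_apply _
  have h2 : Measurable fun f : ({n} : Finset ℕ) → ℝ => f ⟨n, Finset.mem_singleton_self n⟩ :=
    measurable_pi_apply _
  exact h.comp h1 h2

variable [IsProbabilityMeasure μ]

/-- Conditioning on an event of positive probability that depends on `Y` only keeps `Z` independent
of `Y` and does not change the law of `Z`. -/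
theorem map_prodMk_cond_eq_prod {E : Type*} [MeasurableSpace E] {Z : Ω → E} {Y : Ω → ℝ}
    (hZ : Measurable Z) (hY : Measurable Y) (hind : IndepFun Z Y μ) {B : Set ℝ}
    (hB : MeasurableSet B) :
    (μ[|Y ⁻¹' B]).map (fun ω => (Z ω, Y ω)) = (μ.map Z).prod ((μ[|Y ⁻¹' B]).map Y) := by
  refine (Measure.prod_eq fun s t hs ht => ?_).symm
  rw [Measure.map_apply (hZ.prodMk hY) (hs.prod ht), Measure.map_apply hZ hs,
    Measure.map_apply hY ht, cond_apply (hY hB), cond_apply (hY hB)]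
  have e1 : Y ⁻¹' B ∩ (fun ω => (Z ω, Y ω)) ⁻¹' s ×ˢ t = Z ⁻¹' s ∩ Y ⁻¹' (B ∩ t) := by
    ext ω
    simp only [Set.mem_inter_iff, Set.mem_preimage, Set.mem_prod]
    tauto
  rw [e1, hind.measure_inter_preimage_eq_mul _ _ hs (hB.inter ht), Set.preimage_inter]
  ring

/-- The conditioned joint law is a product, so the constant kernel disintegrates it and uniqueness
of disintegrations applies. As `Z` keeps its law, the exceptional set is also null under `μ`. -/
theorem ae_condDistrib_cond {E : Type*} [MeasurableSpace E] {Z : Ω → E} {Y : Ω → ℝ}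
    (hZ : Measurable Z) (hY : Measurable Y) (hind : IndepFun Z Y μ) {B : Set ℝ}
    (hB : MeasurableSet B) (h0 : μ (Y ⁻¹' B) ≠ 0) :
    ∀ᵐ ω ∂μ, condDistrib Y Z (μ[|Y ⁻¹' B]) (Z ω) = (μ[|Y ⁻¹' B]).map Y := by
  have := cond_isProbabilityMeasure h0
  have := Measure.isProbabilityMeasure_map (μ := μ[|Y ⁻¹' B]) hY.aemeasurable
  have hprod := map_prodMk_cond_eq_prod hZ hY hind hB
  have hmap : (μ[|Y ⁻¹' B]).map Z = μ.map Z := by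
    have := congrArg Measure.fst hprod
    rwa [Measure.fst_map_prodMk hY, Measure.fst_prod] at this
  have h := condDistrib_ae_eq_of_measure_eq_compProd (μ := μ[|Y ⁻¹' B]) (Y := Y) Z hY.aemeasurable
    (κ := Kernel.const _ ((μ[|Y ⁻¹' B]).map Y)) (by rw [hprod, hmap, Measure.compProd_const])
  rw [hmap] at h
  filter_upwards [ae_of_ae_map hZ.aemeasurable h] with ω hω
  rw [hω, Kernel.const_apply]

theorem ae_predictiveCDF_eq (hX : ∀ i, Measurable (X i)) (hind : iIndepFun X μ) {n : ℕ} {t : ℝ}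
    (ht : cdf (μ.map (X n)) t < 1) :
    ∀ᵐ ω ∂μ, predictiveCDF μ X n t ω = fun y =>
      max 0 ((cdf (μ.map (X n)) y - cdf (μ.map (X n)) t) / (1 - cdf (μ.map (X n)) t)) := by
  have hXn := hX n
  have := Measure.isProbabilityMeasure_map (μ := μ) hXn.aemeasurable
  have hIic : ∀ y, cdf (μ.map (X n)) y = μ.real (X n ⁻¹' Set.Iic y) := fun y => by
    rw [cdf_eq_real, map_measureReal_apply hXn measurableSet_Iic]
  have hIoi : μ.real (X n ⁻¹' Set.Ioi t) = 1 - cdf (μ.map (X n)) t := by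
    rw [hIic, ← probReal_compl_eq_one_sub (hXn measurableSet_Iic), ← Set.preimage_compl,
      Set.compl_Iic]
  have h0 : μ (X n ⁻¹' Set.Ioi t) ≠ 0 := fun h => by
    rw [measureReal_def, h, ENNReal.toReal_zero] at hIoi
    linarith
  filter_upwards [ae_condDistrib_cond (measurable_sample hX n) hXn (indepFun_sample hX hind n)
    measurableSet_Ioi h0] with ω hω
  ext y
  rw [predictiveCDF, hω, map_measureReal_apply hXn measurableSet_Iic,
    measureReal_def, cond_apply (hXn measurableSet_Ioi), ENNReal.toReal_mul, ENNReal.toReal_inv,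
    ← measureReal_def, ← measureReal_def, hIoi, ← Set.preimage_inter, Set.Ioi_inter_Iic,
    inv_mul_eq_div]
  have hπ : 0 < 1 - cdf (μ.map (X n)) t := by linarith
  -- Below the threshold the conditional probability is 0 and the quotient is nonpositive, which is
  -- why the formula carries `max 0`.
  rcases le_total y t with h | h
  · rw [Set.Ioc_eq_empty (not_lt.2 h), Set.preimage_empty, measureReal_empty, zero_div, max_eq_left]
    exact div_nonpos_of_nonpos_of_nonneg (by linarith [monotone_cdf (μ.map (X n)) h]) hπ.le
  · rw [max_eq_right (div_nonneg (by linarith [monotone_cdf (μ.map (X n)) h]) hπ.le)]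
    congr 1
    rw [← Set.Iic_sdiff_Iic, Set.preimage_sdiff, measureReal_sdiff
      (Set.preimage_mono (Set.Iic_subset_Iic.2 h)) (hXn measurableSet_Iic), hIic, hIic]

end Predictive

/-! ### Intermediate order statistics -/

theorem orderStat_le_iff {n k : ℕ} (x : Fin n → ℝ) (hk : k < n) (q : ℝ) :
    orderStat x (n - k) ≤ q ↔ n - k ≤ (Finset.univ.filter fun i => x i ≤ q).card := by
  have h : 1 ≤ n - k ∧ n - k ≤ n := by omega
  rw [orderStat, dif_pos h]
  have h1 := Tuple.lt_card_le_iff_apply_le_of_monotone (j := ⟨n - k - 1, by omega⟩) (a := q)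
    (Tuple.monotone_sort x)
  simp only [Function.comp] at h1
  rw [← h1]
  have h2 : (Finset.univ.filter fun i => x (Tuple.sort x i) ≤ q).card
      = (Finset.univ.filter fun i => x i ≤ q).card :=
    Finset.card_equiv (Tuple.sort x) (by simp)
  rw [h2]
  omega

section OrderStat

variable {Ω : Type*} [MeasurableSpace Ω] {μ : Measure Ω} [IsProbabilityMeasure μ] {X : ℕ → Ω → ℝ}

/-- Chebyshev bound for the empirical distribution function. -/
theorem measure_abs_card_sub_ge_le (hX : ∀ i, Measurable (X i)) (hind : iIndepFun X μ)
    (hid : ∀ i, IdentDistrib (X i) (X 0) μ μ) (n : ℕ) (q : ℝ) {c : ℝ} (hc : 0 < c) :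
    μ {ω | c ≤ |((Finset.univ.filter fun i => sample X n ω i ≤ q).card : ℝ)
        - n * cdf (μ.map (X 0)) q|}
      ≤ ENNReal.ofReal (n * (1 - cdf (μ.map (X 0)) q) / c ^ 2) := by
  have := Measure.isProbabilityMeasure_map (μ := μ) (hX 0).aemeasurable
  set p := cdf (μ.map (X 0)) q with hp
  set φ : ℝ → ℝ := (Set.Iic q).indicator fun _ => 1 with hφ
  have hφm : Measurable φ := measurable_const.indicator measurableSet_Iic
  have hφ01 : ∀ x, 0 ≤ φ x ∧ φ x ≤ 1 := fun x => by
    by_cases h : x ∈ Set.Iic q <;> simp [hφ, h]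
  set Y : ℕ → Ω → ℝ := fun i => φ ∘ X i with hY
  have hYm : ∀ i, MemLp (Y i) 2 μ := fun i =>
    MemLp.of_bound (hφm.comp (hX i)).aestronglyMeasurable 1 (Eventually.of_forall fun ω => by
      change |φ (X i ω)| ≤ 1
      rw [abs_of_nonneg (hφ01 _).1]
      exact (hφ01 _).2)
  have hEY : ∀ i, ∫ ω, Y i ω ∂μ = p := fun i => by
    have h1 : ∫ ω, Y i ω ∂μ = ∫ ω, Y 0 ω ∂μ := ((hid i).comp hφm).integral_eq
    have h2 : Y 0 = (X 0 ⁻¹' Set.Iic q).indicator fun _ => 1 := by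
      ext ω; simp [hY, hφ, Set.indicator]
    rw [h1, h2, integral_indicator (hX 0 measurableSet_Iic)]
    simp only [integral_const, smul_eq_mul, mul_one, measureReal_restrict_apply_univ]
    rw [hp, cdf_eq_real, map_measureReal_apply (hX 0) measurableSet_Iic]
  have hVar : ∀ i, Var[Y i; μ] = p - p ^ 2 := fun i => by
    rw [variance_eq_sub (hYm i), hEY]
    have : Y i ^ 2 = Y i := by
      ext ω
      by_cases h : X i ω ∈ Set.Iic q <;> simp [hY, hφ, h]
    rw [this, hEY]
  have hsum : ∀ ω, ((Finset.univ.filter fun i => sample X n ω i ≤ q).card : ℝ)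
      = (∑ i ∈ Finset.range n, Y i) ω := fun ω => by
    rw [Finset.sum_apply, Finset.card_filter, ← Fin.sum_univ_eq_sum_range (fun i => Y i ω) n]
    push_cast
    refine Finset.sum_congr rfl fun i _ => ?_
    by_cases h : X i ω ≤ q <;> simp [hY, hφ, h, sample]
  have hES : ∫ ω, (∑ i ∈ Finset.range n, Y i) ω ∂μ = n * p := by
    simp only [Finset.sum_apply]
    rw [integral_finsetSum _ fun i _ => (hYm i).integrable one_le_two]
    simp [hEY]
  have hVS : Var[∑ i ∈ Finset.range n, Y i; μ] = n * (p - p ^ 2) := by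
    rw [IndepFun.variance_sum (fun i _ => hYm i)]
    · rw [Finset.sum_congr rfl fun i _ => hVar i, Finset.sum_const, Finset.card_range, nsmul_eq_mul]
    · exact fun i _ j _ hij => (hind.indepFun hij).comp hφm hφm
  have hcheb := meas_ge_le_variance_div_sq (memLp_finsetSum' _ fun i _ => hYm i :
    MemLp (∑ i ∈ Finset.range n, Y i) 2 μ) hc
  rw [hES, hVS] at hcheb
  simp only [hsum]
  refine hcheb.trans (ENNReal.ofReal_le_ofReal ?_)
  refine div_le_div_of_nonneg_right (mul_le_mul_of_nonneg_left ?_ n.cast_nonneg) (sq_nonneg c)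
  -- The variance `p - p ^ 2` is at most `1 - p`. Keeping this factor is essential: it is of order
  -- `k / n` at intermediate quantiles, so the bound scales with `k` and not with `n`.
  nlinarith [sq_nonneg (1 - p)]

/-- The intermediate order statistic `X_{n-k,n}` lies, with high probability, between the quantiles
of levels `1 - (k / n) (1 ± M / √k)`. -/
theorem measure_orderStat_notMem_Icc_le (hX : ∀ i, Measurable (X i)) (hind : iIndepFun X μ)
    (hid : ∀ i, IdentDistrib (X i) (X 0) μ μ) {n k : ℕ} (hk : 0 < k) (hkn : k < n) {M q₁ q₂ : ℝ}
    (hM : 0 < M) (hMk : M * (1 / √k) ≤ 1)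
    (h₁ : cdf (μ.map (X 0)) q₁ = 1 - (k : ℝ) / n * (1 + M * (1 / √k)))
    (h₂ : cdf (μ.map (X 0)) q₂ = 1 - (k : ℝ) / n * (1 - M * (1 / √k))) :
    μ {ω | ¬ (q₁ ≤ orderStat (sample X n ω) (n - k) ∧ orderStat (sample X n ω) (n - k) ≤ q₂)}
      ≤ ENNReal.ofReal (3 / M ^ 2) := by
  have hk0 : (0 : ℝ) < k := by exact_mod_cast hk
  have hn0 : (0 : ℝ) < n := by exact_mod_cast hk.trans hkn
  have hs : 0 < √(k : ℝ) := Real.sqrt_pos.2 hk0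
  have hs2 : √(k : ℝ) ^ 2 = k := Real.sq_sqrt hk0.le
  have hks : (k : ℝ) * (1 / √k) = √k := by field_simp; exact hs2.symm
  have hMs : 0 < M * √k := by positivity
  have e₁ : n * (1 - cdf (μ.map (X 0)) q₁) = k + M * √k := by
    rw [h₁, ← hks]; field_simp; ring_nf; rw [hs2]
  have e₂ : n * (1 - cdf (μ.map (X 0)) q₂) = k - M * √k := by
    rw [h₂, ← hks]; field_simp; ring_nf; rw [hs2]
  have hMk' : M * √k ≤ k := by
    have := mul_le_mul_of_nonneg_left hMk hk0.le
    rw [← mul_assoc, mul_comm (k : ℝ) M, mul_assoc, hks] at this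
    linarith
  have b₁ := measure_abs_card_sub_ge_le hX hind hid n q₁ hMs
  have b₂ := measure_abs_card_sub_ge_le hX hind hid n q₂ hMs
  rw [e₁] at b₁
  rw [e₂] at b₂
  have hcast : ((n - k : ℕ) : ℝ) = n - k := Nat.cast_sub hkn.le
  refine (measure_mono (t := _ ∪ _) fun ω hω => ?_).trans ((measure_union_le _ _).trans
    ((add_le_add b₁ b₂).trans ?_))
  · rw [Set.mem_ofPred_eq, not_and_or] at hω
    rcases hω with h | h
    · left
      have h' := (orderStat_le_iff _ hkn q₁).1 (not_le.1 h).le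
      have h2 : ((n - k : ℕ) : ℝ) ≤ _ := Nat.cast_le.2 h'
      rw [hcast] at h2
      rw [Set.mem_ofPred_eq]
      refine le_trans ?_ (le_abs_self _)
      linarith
    · right
      rw [orderStat_le_iff _ hkn, not_le] at h
      have h2 : _ < ((n - k : ℕ) : ℝ) := Nat.cast_lt.2 h
      rw [hcast] at h2
      rw [Set.mem_ofPred_eq]
      refine le_trans ?_ (neg_le_abs _)
      linarith
  · rw [← ENNReal.ofReal_add (by positivity) (div_nonneg (by linarith) (by positivity))]
    refine ENNReal.ofReal_le_ofReal ?_
    -- The terms `k ± M√k` sum to `2k`, so the two Chebyshev bounds add up to `2 / M ^ 2`.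
    rw [← add_div, div_le_div_iff₀ (by positivity) (by positivity), mul_pow, hs2]
    nlinarith [sq_nonneg M, mul_pos (pow_pos hM 2) hk0]

end OrderStat

/-! ### Consequences of the second-order von Mises condition -/

theorem quantile_monotoneOn {P : Measure ℝ} :
    MonotoneOn (quantile (cdf P)) (Set.Ioo 0 1) := fun _ hp _ hr hpr =>
  (quantile_le_iff hp.1 hp.2 _).2 (hpr.trans ((quantile_le_iff hr.1 hr.2 _).1 le_rfl))

theorem measurable_vonMisesRate (Q : ℝ → ℝ) (γ : ℝ) : Measurable (vonMisesRate Q γ) := by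
  unfold vonMisesRate
  have h1 : Measurable fun t : ℝ => 1 - 1 / t := by fun_prop
  have h2 := (measurable_deriv Q).comp h1
  have h3 := (measurable_deriv (deriv Q)).comp h1
  exact ((((h3.div measurable_id).sub (h2.const_mul 2)).div h2).add_const 1).sub_const γ

theorem tendsto_one_sub_one_div : Tendsto (fun t : ℝ => 1 - 1 / t) atTop (𝓝[<] 1) := by
  refine tendsto_nhdsWithin_iff.2 ⟨?_, ?_⟩
  · have := (tendsto_inv_atTop_zero (𝕜 := ℝ)).const_sub 1
    simpa using this
  · filter_upwards [eventually_gt_atTop 0] with t ht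
    have : 0 < 1 / t := by positivity
    exact Set.mem_Iio.2 (by linarith)

/-- Monotonicity of the quantile function gives `Q' ≥ 0`. Where `Q' = 0`, division by zero makes the
rate function equal to `1 - γ`. This is excluded near infinity: by `A → 0` if `γ ≠ 1`, and by the
eventual nonvanishing of `|A|` if `γ = 1`. -/
theorem SecondOrderVonMises.eventually_deriv_pos {P : Measure ℝ} {a : ℝ → ℝ} {γ ρ : ℝ}
    (h : SecondOrderVonMises (cdf P) a γ ρ) :
    ∀ᶠ t in atTop, 0 < deriv (quantile (cdf P)) (1 - 1 / t) := by
  have hne : ∀ᶠ t in atTop, vonMisesRate (quantile (cdf P)) γ t ≠ 0 :=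
    h.secondOrder.A_regVar.eventually_ne_zero.mono fun t ht => abs_ne_zero.1 ht
  have hA : ∀ᶠ t in atTop, vonMisesRate (quantile (cdf P)) γ t ≠ 1 - γ := by
    by_cases hγ : 1 - γ = 0
    · rwa [hγ]
    · exact h.secondOrder.A_tendsto.eventually_ne (Ne.symm hγ)
  filter_upwards [hA, eventually_gt_atTop 1] with t ht ht1
  have hmem : 1 - 1 / t ∈ Set.Ioo (0 : ℝ) 1 := by
    have h1 : 1 / t < 1 := by rw [div_lt_one (by linarith)]; exact ht1
    have h2 : 0 < 1 / t := by positivity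
    exact ⟨by linarith, by linarith⟩
  refine lt_of_le_of_ne ?_ fun h0 => ht ?_
  · rw [← derivWithin_of_isOpen isOpen_Ioo hmem]
    exact quantile_monotoneOn.derivWithin_nonneg
  · rw [vonMisesRate, ← h0, div_zero, zero_add]

/-- The derivative of `t ↦ Q (1 - 1 / t)`. -/
noncomputable def tailDeriv (Q : ℝ → ℝ) (t : ℝ) : ℝ := deriv Q (1 - 1 / t) / t ^ 2

/-- With `U(t) = Q(1 - 1/t)` the chain rule gives `U'(t) = Q'(1 - 1/t) / t²` and `t U''/U' = Q''/(t
Q') - 2`, which is `γ - 1 + A(t)` by definition of the rate. -/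
theorem SecondOrderVonMises.exists_vonMisesTail {P : Measure ℝ} {a : ℝ → ℝ} {γ ρ : ℝ}
    (h : SecondOrderVonMises (cdf P) a γ ρ) :
    ∃ T, 1 ≤ T ∧ VonMisesTail (fun t => quantile (cdf P) (1 - 1 / t))
      (tailDeriv (quantile (cdf P))) (vonMisesRate (quantile (cdf P)) γ) γ T ∧
      ∀ t, T ≤ t → ContinuousAt (quantile (cdf P)) (1 - 1 / t) := by
  obtain ⟨T, hT⟩ := eventually_atTop.1 (h.eventually_deriv_pos.and
    (tendsto_one_sub_one_div.eventually h.quantile_diff))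
  have hpos : ∀ t, max T 1 ≤ t → 0 < t := fun t ht => by linarith [(le_max_right T 1).trans ht]
  have hinner : ∀ t : ℝ, 0 < t → HasDerivAt (fun t => 1 - 1 / t) (1 / t ^ 2) t := fun t ht => by
    convert! (hasDerivAt_inv ht.ne').const_sub 1 using 1
    · ext s; rw [one_div]
    · rw [neg_neg, one_div]
  refine ⟨max T 1, le_max_right _ _, ⟨by positivity, fun t ht => ?_, fun t ht => ?_, fun t ht => ?_⟩,
    fun t ht => (hT t ((le_max_left _ _).trans ht)).2.1.continuousAt⟩
  all_goals
    have ht0 := hpos t ht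
    obtain ⟨h1, h2, h3⟩ := hT t ((le_max_left _ _).trans ht)
  · unfold tailDeriv; positivity
  · have := h2.hasDerivAt.comp t (hinner t ht0)
    convert! this using 1
    rw [tailDeriv]; ring
  · have := (h3.hasDerivAt.comp t (hinner t ht0)).div (hasDerivAt_pow 2 t) (by positivity)
    convert! this using 1
    simp only [vonMisesRate, tailDeriv, Function.comp]
    have hd := h1.ne'
    generalize deriv (deriv (quantile (cdf P))) (1 - 1 / t) = d₂
    generalize deriv (quantile (cdf P)) (1 - 1 / t) = d₁ at hd ⊢
    field_simp
    ring

theorem VonMisesTail.strictMonoOn_of_comp {Q D A : ℝ → ℝ} {γ T : ℝ}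
    (h : VonMisesTail (fun t => Q (1 - 1 / t)) D A γ T) :
    StrictMonoOn Q (Set.Ioo (1 - 1 / T) 1) := by
  have hT := h.pos
  have key : ∀ p ∈ Set.Ioo (1 - 1 / T) 1, T ≤ 1 / (1 - p) ∧ 1 - 1 / (1 / (1 - p)) = p := by
    intro p hp
    have h1 : 0 < 1 - p := by linarith [hp.2]
    refine ⟨?_, by rw [one_div_one_div]; ring⟩
    rw [le_div_iff₀ h1, ← le_div_iff₀' hT]
    linarith [hp.1]
  intro p hp r hr hpr
  obtain ⟨h1, e1⟩ := key p hp
  obtain ⟨h2, e2⟩ := key r hr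
  have h3 := h.strictMonoOn h1 h2 (one_div_lt_one_div_of_lt (by linarith [hr.2]) (by linarith))
  simpa only [e1, e2] using h3

/-- The scaling function of the second-order condition agrees with `t U'(t)` up to a relative error
of the order of the rate function. -/
theorem VonMisesTail.exists_abs_scale_sub_one_le {Q a D A : ℝ → ℝ} {γ ρ T : ℝ}
    (h : VonMisesTail (fun t => Q (1 - 1 / t)) D A γ T) (hA : Measurable A)
    (hSO : SecondOrder Q a A γ ρ) :
    ∃ C, 0 < C ∧ ∀ᶠ t in atTop, |t * D t / a t - 1| ≤ C * |A t| := by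
  obtain ⟨C₁, t₁, hC₁, hA₁⟩ := hSO.A_regVar.exists_le_mul hA.abs (fun t => abs_nonneg _) 2
  obtain ⟨C₂, c, hC₂, hc, hz⟩ := exists_abs_sub_boxCox_le γ
  have hu : Tendsto (fun t : ℝ => 1 / t) atTop (𝓝[>] 0) := by
    simpa only [one_div] using tendsto_inv_atTop_nhdsGT_zero (𝕜 := ℝ)
  have hexp := ((hSO.expansion (1 / 2) (by norm_num)).comp hu).abs
  set L := |∫ v in (1 : ℝ)..(1 / (1 / 2)), v ^ (γ - 1) * ∫ r in (1 : ℝ)..v, r ^ (ρ - 1)|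
  have hL : 0 ≤ L := abs_nonneg _
  have hA0 : Tendsto (fun t => |A t|) atTop (𝓝 0) := by simpa using hSO.A_tendsto.abs
  have hB := boxCox_pos γ one_lt_two
  set B := boxCox γ 2
  set W := 1 + weight γ 2
  have hW : 1 ≤ W := by linarith [weight_nonneg γ one_le_two]
  set E := (2 : ℝ) ^ γ * W
  have hE : 0 < E := by positivity
  refine ⟨(L + 1 + C₂ * C₁ * E) * (2 / B), by positivity, ?_⟩
  filter_upwards [hexp.eventually (gt_mem_nhds (lt_add_one L)), eventually_ge_atTop t₁,
    eventually_ge_atTop T, hSO.a_pos, hSO.A_regVar.eventually_ne_zero,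
    hA0.eventually (ge_mem_nhds (show 0 < c / (C₁ * W) by positivity)),
    hA0.eventually (ge_mem_nhds (show 0 < B / 2 / (C₂ * C₁ * E) by positivity))]
    with t h1 h2 h3 h4 h5 h6 h7
  have ht0 := h.pos.trans_le h3
  have hD := h.deriv_pos t h3
  rw [le_div_iff₀ (by positivity)] at h6 h7
  have hAt : 0 < |A t| := lt_of_le_of_ne (abs_nonneg _) (Ne.symm h5)
  obtain ⟨b1, b2⟩ := h.increment_bounds h3 one_le_two (η := C₁ * |A t|) (by positivity)
    fun v hv hv2 => hA₁ t h2 v hv hv2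
  have hz' := hz _ _ _ (by positivity) one_le_two (by linarith) b1 b2
  simp only [Function.comp] at h1
  rw [one_div_one_div, one_div (2 : ℝ),
    gpTailQuantile_inv two_pos, abs_mul, abs_div, abs_one, one_div_mul_eq_div, div_lt_iff₀ hAt] at h1
  set z := (Q (1 - 1 / (t * 2)) - Q (1 - 1 / t)) / (t * D t) with hzdef
  set r := t * D t / a t with hr
  have hzr : (Q (1 - 1 / t * 2⁻¹) - Q (1 - 1 / t)) / a t = z * r := by
    rw [hzdef, hr, show 1 / (t * 2) = 1 / t * 2⁻¹ by field_simp]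
    field_simp
  rw [hzr] at h1
  have hz2 : |z - B| ≤ C₂ * C₁ * E * |A t| := hz'.trans_eq (by ring)
  have hzB : B / 2 ≤ z := by linarith [(abs_le.1 hz2).1]
  -- For the single step from `t` to `2t`, the von Mises bounds put `z` near `B` and the
  -- second-order expansion puts `z * r` near `B`, both up to `O(|A t|)`. Since `z ≥ B / 2`, the
  -- factor `z` can be divided out.
  have h8 : |(r - 1) * z| ≤ (L + 1 + C₂ * C₁ * E) * |A t| := by
    rw [show (r - 1) * z = (z * r - B) - (z - B) by ring]
    refine (abs_sub _ _).trans ?_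
    linarith
  rw [abs_mul, abs_of_pos (by linarith : 0 < z)] at h8
  have h9 : |r - 1| * (B / 2) ≤ (L + 1 + C₂ * C₁ * E) * |A t| :=
    (mul_le_mul_of_nonneg_left hzB (abs_nonneg _)).trans h8
  rw [← le_div_iff₀ (by positivity)] at h9
  exact h9.trans_eq (by field_simp)

/-- Uniform bound for the rate function between the intermediate and the extreme level. -/
theorem exists_rate_le {A : ℝ → ℝ} {ρ τ₀ : ℝ} (hA : Measurable A)
    (hreg : RegularlyVarying (fun t => |A t|) ρ) (hρ : ρ ≤ 0) (hτ₀0 : 0 ≤ τ₀) {t τ : ℕ → ℝ}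
    (ht : Tendsto t atTop atTop) (hτ : Tendsto τ atTop (𝓝 τ₀))
    (hmono : ρ = 0 → τ₀ = 0 → ∃ t₀ : ℝ, AntitoneOn (fun t => |A t|) (Set.Ici t₀)) :
    ∃ C, 0 < C ∧ ∀ᶠ n in atTop, ∀ v, 1 ≤ v → v ≤ 1 / τ n → |A (t n * v)| ≤ C * |A (t n)| := by
  -- If `τ₀ > 0` the range of `v` is bounded and the local bound suffices. If `τ₀ = 0` it need not
  -- be, and control for all `v ≥ 1` comes from `ρ < 0` or from monotonicity.
  rcases hτ₀0.eq_or_lt with h0 | h0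
  · rcases hρ.eq_or_lt with h | h
    · obtain ⟨t₀, h₀⟩ := hmono h h0.symm
      refine ⟨1, one_pos, ?_⟩
      filter_upwards [ht.eventually (eventually_ge_atTop t₀), ht.eventually (eventually_ge_atTop 0)]
        with n hn hn0 v hv _
      have := le_mul_of_one_le_right hn0 hv
      rw [one_mul]
      exact h₀ hn (hn.trans this) this
    · obtain ⟨C, t₀, hC, hle⟩ := hreg.exists_le_mul_of_neg hA.abs (fun _ => abs_nonneg _) h
      refine ⟨C, hC, ?_⟩
      filter_upwards [ht.eventually (eventually_ge_atTop t₀)] with n hn v hv _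
      exact hle _ hn v hv
  · obtain ⟨C, t₀, hC, hle⟩ := hreg.exists_le_mul hA.abs (fun _ => abs_nonneg _) (1 / τ₀ + 1)
    refine ⟨C, hC, ?_⟩
    have h1 : Tendsto (fun n => 1 / τ n) atTop (𝓝 (1 / τ₀)) := by
      simpa only [one_div] using hτ.inv₀ h0.ne'
    filter_upwards [ht.eventually (eventually_ge_atTop t₀),
      h1.eventually (ge_mem_nhds (lt_add_one _))] with n hn hn1 v hv hvn
    exact hle _ hn v hv (hvn.trans hn1)

/-- Here `z` is the increment of `U` and `d` the location error, both on the scale `t U'(t)`; `r`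
compares that scale with `a(t)`, and `s` is `σ̂ / a(t)`. The combination `(z - d) * r / s` is the
argument of the estimated Pareto tail. -/
theorem abs_mul_div_sub_le {z d r s B E δ C₁ C₂ C₃ C₄ C₅ : ℝ}
    (hE : 1 ≤ E) (hC₁ : 0 ≤ C₁) (hC₂ : 0 ≤ C₂)
    (hz : |z - B| ≤ C₁ * (δ * E)) (hd : |d| ≤ C₂ * δ)
    (hr : |r - 1| ≤ C₃ * δ) (hs : |s - 1| ≤ C₄ * δ) (hB : |B| ≤ C₅ * E) (hδ : 0 ≤ δ)
    (h₃ : C₃ * δ ≤ 1) (h₄ : C₄ * δ ≤ 1 / 2) :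
    |(z - d) * r / s - B| ≤ (4 * (C₁ + C₂) + 2 * C₅ * (C₃ + C₄)) * (δ * E) := by
  have hs2 : 1 / 2 ≤ s := by linarith [(abs_le.1 hs).1]
  have hr2 : |r| ≤ 2 := by
    have := abs_sub_abs_le_abs_sub r 1
    rw [abs_one] at this
    linarith
  have e : (z - d) * r / s - B = ((z - B) * r - d * r + B * ((r - 1) - (s - 1))) / s := by
    field_simp
    ring
  have hd' : |d| ≤ C₂ * (δ * E) := hd.trans (by gcongr; exact le_mul_of_one_le_right hδ hE)
  have hrs : |(r - 1) - (s - 1)| ≤ C₃ * δ + C₄ * δ := (abs_sub _ _).trans (by linarith)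
  have hnum : |(z - B) * r - d * r + B * ((r - 1) - (s - 1))|
      ≤ C₁ * (δ * E) * 2 + C₂ * (δ * E) * 2 + C₅ * E * (C₃ * δ + C₄ * δ) := by
    refine (abs_add_le _ _).trans (add_le_add ((abs_sub _ _).trans (add_le_add ?_ ?_)) ?_) <;>
      rw [abs_mul]
    · gcongr
    · gcongr
    · have := (abs_nonneg B).trans hB
      gcongr
  rw [e, abs_div, abs_of_pos (by linarith : 0 < s), div_le_iff₀ (by linarith)]
  refine hnum.trans ?_
  have h0 := (abs_nonneg _).trans hnum
  nlinarith

/-! ### Stochastic orders -/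

section Orders

variable {Ω : Type*} [MeasurableSpace Ω] {μ : Measure Ω}

theorem BigOP.congr_ae {Y Z : ℕ → Ω → ℝ} {r : ℕ → ℝ} (h : BigOP μ Y r)
    (hYZ : ∀ᶠ n in atTop, Y n =ᵐ[μ] Z n) : BigOP μ Z r := fun δ hδ => by
  obtain ⟨M, hM, hn⟩ := h δ hδ
  refine ⟨M, hM, ?_⟩
  filter_upwards [hn, hYZ] with n hn hn'
  refine le_trans (measure_mono_ae ?_) hn
  filter_upwards [hn'] with ω hω h'
  change M * |r n| < |Y n ω|
  rw [hω]
  exact h'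

theorem BigOP.mono {Y : ℕ → Ω → ℝ} {r s : ℕ → ℝ} (h : BigOP μ Y r) {K : ℝ} (hK : 0 < K)
    (hrs : ∀ᶠ n in atTop, |r n| ≤ K * |s n|) : BigOP μ Y s := fun δ hδ => by
  obtain ⟨M, hM, hn⟩ := h δ hδ
  refine ⟨M * K, by positivity, ?_⟩
  filter_upwards [hn, hrs] with n hn hn'
  refine (measure_mono fun ω hω => ?_).trans hn
  refine lt_of_le_of_lt ?_ (Set.mem_ofPred_eq ▸ hω)
  rw [mul_assoc]
  gcongr

theorem BigOP.tendstoInMeasure_one {Y : ℕ → Ω → ℝ} {r : ℕ → ℝ}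
    (h : BigOP μ (fun n ω => Y n ω - 1) r) (hr : Tendsto r atTop (𝓝 0)) :
    TendstoInMeasure μ Y atTop fun _ => 1 := by
  refine tendstoInMeasure_iff_norm.2 fun e he => ENNReal.tendsto_nhds_zero.2 fun d hd => ?_
  rcases eq_or_ne d ⊤ with rfl | hd'
  · exact Eventually.of_forall fun _ => le_top
  obtain ⟨M, hM, hn⟩ := h d.toReal (ENNReal.toReal_pos hd.ne' hd')
  rw [ENNReal.ofReal_toReal hd'] at hn
  have hr0 : Tendsto (fun n => |r n|) atTop (𝓝 0) := by simpa using hr.abs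
  filter_upwards [hn, hr0.eventually (gt_mem_nhds (show 0 < e / M by positivity))] with n hn hn'
  refine (measure_mono fun ω hω => ?_).trans hn
  rw [lt_div_iff₀ hM] at hn'
  rw [Set.mem_ofPred_eq] at hω ⊢
  rw [Real.norm_eq_abs] at hω
  linarith

end Orders

/-! ### Levels and tail ratios -/

theorem one_sub_tauI (k : ℕ → ℕ) (n : ℕ) : 1 - tauI k n = (k n : ℝ) / n := by
  rw [tauI, sub_sub_cancel]

theorem one_sub_tauE (ν : ℕ → ℝ) (n : ℕ) : 1 - tauE ν n = ν n / n := by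
  rw [tauE, sub_sub_cancel]

theorem tauStar_eq {k : ℕ → ℕ} {ν : ℕ → ℝ} {n : ℕ} (hn : n ≠ 0) :
    tauStar k ν n = ν n / k n := by
  rw [tauStar, one_sub_tauE, one_sub_tauI]
  have : (n : ℝ) ≠ 0 := by exact_mod_cast hn
  field_simp

theorem one_div_tauStar_ge_one {k : ℕ → ℕ} {ν : ℕ → ℝ} {n : ℕ} (hn : n ≠ 0)
    (hν : 0 < ν n ∧ ν n ≤ k n) : 0 < tauStar k ν n ∧ 1 ≤ 1 / tauStar k ν n := by
  have hk : (0 : ℝ) < k n := hν.1.trans_le hν.2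
  rw [tauStar_eq hn, one_div_div, one_le_div hν.1]
  exact ⟨div_pos hν.1 hk, hν.2⟩

theorem tendsto_one_div_sqrt {k : ℕ → ℕ} (hk : Tendsto k atTop atTop) :
    Tendsto (fun n => 1 / √(k n : ℝ)) atTop (𝓝 0) := by
  have := (Real.tendsto_sqrt_atTop.comp (tendsto_natCast_atTop_atTop.comp hk)).inv_tendsto_atTop
  refine this.congr fun n => ?_
  simp

theorem tendsto_div_atTop {k : ℕ → ℕ} (hk : Tendsto k atTop atTop)
    (hkn : (fun n => (k n : ℝ)) =o[atTop] (fun n => (n : ℝ))) :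
    Tendsto (fun n : ℕ => (n : ℝ) / k n) atTop atTop := by
  have h1 : Tendsto (fun n : ℕ => (k n : ℝ) / n) atTop (𝓝[>] 0) := by
    refine tendsto_nhdsWithin_iff.2 ⟨hkn.tendsto_div_nhds_zero, ?_⟩
    filter_upwards [hk.eventually (eventually_gt_atTop 0), eventually_gt_atTop 0] with n hkn hn
    have h1 : (0 : ℝ) < k n := by exact_mod_cast hkn
    have h2 : (0 : ℝ) < n := by exact_mod_cast hn
    exact Set.mem_Ioi.2 (div_pos h1 h2)
  refine (h1.inv_tendsto_nhdsGT_zero).congr fun n => ?_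
  simp

/-- The tail ratio of the forecaster for tail events is that of the forecaster for peaks at the
extreme quantile. -/
theorem tailRatio_freqTailForecaster {Ω : Type*} (X : ℕ → Ω → ℝ) (F : ℝ → ℝ) {k : ℕ → ℕ} {ν : ℕ → ℝ}
    (T₁ T₂ : ∀ n, (Fin (k n + 1) → ℝ) → ℝ) (ω : Ω) {n : ℕ} (hn : n ≠ 0)
    (hν : 0 < ν n ∧ ν n ≤ k n) :
    tailRatio (fun n => 1 - tauE ν n) (freqTailForecaster X k T₁ T₂) (fun _ _ => F) n ω
      = 1 / tauStar k ν n *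
        (1 - freqPeakForecaster X k T₁ T₂ n ω (quantile F (tauE ν n))) := by
  have hk : (0 : ℝ) < k n := hν.1.trans_le hν.2
  have hn0 : (n : ℝ) ≠ 0 := by exact_mod_cast hn
  have h1 := one_sub_tauI k n
  rw [tailRatio, freqTailForecaster, sub_sub_cancel, one_sub_tauE, tauStar_eq hn,
    show ∀ H, 1 - (tauI k n + (1 - tauI k n) * H) = (1 - tauI k n) * (1 - H) by intro H; ring, h1]
  have := hν.1.ne'
  field_simp

/-- The exceedance quantile at `1 - τ*` is the quantile of `F` at `τ_I + (1 - τ*)(1 - τ_I) = τ_E`,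
so this ratio coincides almost surely with that of the tail-event forecaster. -/
theorem ae_tailRatio_freqPeakForecaster {Ω : Type*} [MeasurableSpace Ω] {μ : Measure Ω}
    [IsProbabilityMeasure μ] {X : ℕ → Ω → ℝ} (hX : ∀ i, Measurable (X i)) (hind : iIndepFun X μ)
    (hid : ∀ i, IdentDistrib (X i) (X 0) μ μ) {k : ℕ → ℕ} {ν : ℕ → ℝ}
    (T₁ T₂ : ∀ n, (Fin (k n + 1) → ℝ) → ℝ) {n : ℕ} (hn : n ≠ 0)
    (hν : 0 < ν n ∧ ν n ≤ k n) {p₀ : ℝ} (hp₀ : 0 ≤ p₀)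
    (hQ : StrictMonoOn (quantile (cdf (μ.map (X 0)))) (Set.Ioo p₀ 1))
    (hp : tauI k n ∈ Set.Ioo p₀ 1)
    (hQc : ContinuousAt (quantile (cdf (μ.map (X 0)))) (tauI k n)) :
    ∀ᵐ ω ∂μ, tailRatio (tauStar k ν) (freqPeakForecaster X k T₁ T₂)
        (fun n => predictiveCDF μ X n (quantile (cdf (μ.map (X 0))) (tauI k n))) n ω
      = 1 / tauStar k ν n *
        (1 - freqPeakForecaster X k T₁ T₂ n ω (quantile (cdf (μ.map (X 0))) (tauE ν n))) := by
  have ht := cdf_quantile hp₀ hQ hp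
  have hmap : μ.map (X n) = μ.map (X 0) := (hid n).map_eq
  have hpred := ae_predictiveCDF_eq hX hind (n := n)
    (t := quantile (cdf (μ.map (X 0))) (tauI k n)) (by rw [hmap, ht]; exact hp.2)
  obtain ⟨hs, hs1⟩ := one_div_tauStar_ge_one hn hν
  rw [one_le_div hs] at hs1
  filter_upwards [hpred] with ω hω
  rw [tailRatio, hω, hmap, quantile_exceedance hp₀ hQ hp hQc ht (by linarith)]
  have h1 : tauI k n + (1 - tauStar k ν n) * (1 - tauI k n) = tauE ν n := by
    have : 1 - tauI k n ≠ 0 := by linarith [hp.2]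
    have h2 : tauStar k ν n * (1 - tauI k n) = 1 - tauE ν n := by
      rw [tauStar, div_mul_cancel₀ _ this]
    linear_combination -h2
  rw [h1, one_div_mul_eq_div]

/-- Deterministic rate of the normalized extreme quantile increment, relative to the intermediate
level. -/
theorem VonMisesTail.exists_abs_increment_sub_boxCox_le {U D A : ℝ → ℝ} {γ T : ℝ}
    (h : VonMisesTail U D A γ T) {t y δ : ℕ → ℝ} (ht : Tendsto t atTop atTop)
    (hy : ∀ᶠ n in atTop, 1 ≤ y n) (hδ : ∀ n, 0 ≤ δ n)
    (hδw : Tendsto (fun n => δ n * (1 + weight γ (y n))) atTop (𝓝 0)) {C₀ : ℝ} (hC₀ : 0 < C₀)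
    (hA : ∀ᶠ n in atTop, ∀ v, 1 ≤ v → v ≤ y n → |A (t n * v)| ≤ C₀ * δ n) :
    ∃ C, 0 < C ∧ ∀ᶠ n in atTop,
      |(U (t n * y n) - U (t n)) / (t n * D (t n)) - boxCox γ (y n)|
        ≤ C * (δ n * (y n ^ γ * (1 + weight γ (y n)))) := by
  obtain ⟨C, c, hC, hc, hz⟩ := exists_abs_sub_boxCox_le γ
  refine ⟨C * C₀, by positivity, ?_⟩
  filter_upwards [ht.eventually (eventually_ge_atTop T), hy, hA,
    hδw.eventually (ge_mem_nhds (show 0 < c / C₀ by positivity))] with n h1 h2 h3 h4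
  rw [le_div_iff₀ hC₀] at h4
  have h5 : 0 ≤ C₀ * δ n := mul_nonneg hC₀.le (hδ n)
  obtain ⟨b1, b2⟩ := h.increment_bounds h1 h2 h5 h3
  exact (hz _ _ _ h5 h2 (by linarith) b1 b2).trans_eq (by ring)

/-- The intermediate order statistic estimates the intermediate quantile at the rate `1 / √k`, on
the scale `t U'(t)`, `t = n / k`. -/
theorem bigOP_orderStat_sub_quantile {Ω : Type*} [MeasurableSpace Ω] {μ : Measure Ω}
    [IsProbabilityMeasure μ] {X : ℕ → Ω → ℝ} (hX : ∀ i, Measurable (X i)) (hind : iIndepFun X μ)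
    (hid : ∀ i, IdentDistrib (X i) (X 0) μ μ) {D A : ℝ → ℝ} {γ T : ℝ} (hT : 1 ≤ T)
    (h : VonMisesTail (fun t => quantile (cdf (μ.map (X 0))) (1 - 1 / t)) D A γ T)
    (hA : Tendsto A atTop (𝓝 0)) {k : ℕ → ℕ} (hk : Tendsto k atTop atTop)
    (hkn : (fun n => (k n : ℝ)) =o[atTop] (fun n => (n : ℝ))) :
    BigOP μ (fun n ω => (orderStat (sample X n ω) (n - k n)
        - quantile (cdf (μ.map (X 0))) (tauI k n)) / (n / k n * D (n / k n)))
      (fun n => 1 / √(k n)) := by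
  intro θ hθ
  set Q := quantile (cdf (μ.map (X 0))) with hQdef
  have hp₀ : 0 ≤ 1 - 1 / T := by
    have : 1 / T ≤ 1 := by rw [div_le_one (by linarith)]; exact hT
    linarith
  have hQ := h.strictMonoOn_of_comp
  have hA1 : ∀ᶠ s in atTop, |A s| ≤ 1 := by
    have := hA.abs
    rw [abs_zero] at this
    exact this.eventually (ge_mem_nhds one_pos)
  obtain ⟨T₁, hT₁⟩ := eventually_atTop.1 hA1
  have h' : VonMisesTail (fun t => Q (1 - 1 / t)) D A γ (max T T₁) :=
    ⟨h.pos.trans_le (le_max_left _ _), fun t ht => h.deriv_pos t ((le_max_left _ _).trans ht),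
      fun t ht => h.hasDerivAt t ((le_max_left _ _).trans ht),
      fun t ht => h.hasDerivAt_deriv t ((le_max_left _ _).trans ht)⟩
  set M : ℝ := √(3 / θ) with hMdef
  have hM : 0 < M := Real.sqrt_pos.2 (by positivity)
  set K : ℝ := 2 ^ (|γ| + 2)
  have hK : 0 < K := by positivity
  -- `M` solves `3 / M ^ 2 = θ`, `K` is the local Lipschitz constant of `U`, and the factor 2 comes
  -- from `|x⁻¹ - 1| ≤ 2 |x - 1|` for `x ≥ 1 / 2`.
  refine ⟨K * (2 * M), by positivity, ?_⟩
  have hδ := tendsto_one_div_sqrt hk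
  filter_upwards [(tendsto_div_atTop hk hkn).eventually (eventually_ge_atTop (2 * max T T₁)),
    (tendsto_div_atTop hk hkn).eventually (eventually_gt_atTop (2 * T)),
    (tendsto_div_atTop hk hkn).eventually (eventually_gt_atTop 1),
    hk.eventually (eventually_gt_atTop 0),
    hδ.eventually (ge_mem_nhds (show 0 < 1 / (2 * M) by positivity))] with n h1 h1' h2 h3 h4
  have hk0 : (0 : ℝ) < k n := by exact_mod_cast h3
  have hkn' : k n < n := by
    rw [one_lt_div hk0] at h2
    exact_mod_cast h2
  have hn0 : (0 : ℝ) < n := by exact_mod_cast h3.trans hkn'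
  set δ := 1 / √(k n : ℝ) with hδdef
  have hδ0 : 0 < δ := by positivity
  rw [le_div_iff₀ (by positivity)] at h4
  set t := (n : ℝ) / k n with htdef
  have ht0 : 0 < t := by positivity
  have hU : ∀ x, 0 < x → Q (1 - (k n : ℝ) / n * x) = Q (1 - 1 / (t * x⁻¹)) := fun x hx => by
    congr 2
    rw [htdef]
    field_simp
  have hF : ∀ x, 0 < x → x ≤ 2 → cdf (μ.map (X 0)) (Q (1 - (k n : ℝ) / n * x))
      = 1 - (k n : ℝ) / n * x := fun x hx hx2 => by
    refine cdf_quantile hp₀ hQ ⟨?_, by linarith [show 0 < (k n : ℝ) / n * x by positivity]⟩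
    have hTpos := h.pos
    have e : (k n : ℝ) / n * x = 1 / (t * x⁻¹) := by rw [htdef]; field_simp
    rw [e]
    have : T < t * x⁻¹ := by
      rw [← div_eq_mul_inv, lt_div_iff₀ hx]
      nlinarith
    linarith [one_div_lt_one_div_of_lt hTpos this]
  have hbound := measure_orderStat_notMem_Icc_le hX hind hid h3 hkn' hM (by linarith)
    (hF (1 + M * δ) (by positivity) (by linarith)) (hF (1 - M * δ) (by linarith) (by nlinarith))
  rw [hMdef, Real.sq_sqrt (by positivity), show 3 / (3 / θ) = θ by field_simp] at hbound
  refine (measure_mono fun ω hω => ?_).trans hbound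
  rw [Set.mem_ofPred_eq] at hω ⊢
  intro ⟨c1, c2⟩
  refine absurd hω (not_lt.2 ?_)
  have hinc : ∀ x, 1 / 2 ≤ x → x ≤ 2 →
      |Q (1 - (k n : ℝ) / n * x) - Q (tauI k n)| ≤ t * D t * (K * (2 * |x - 1|)) := by
    intro x hx hx2
    have hx0 : 0 < x := by linarith
    have h5 := h'.abs_increment_le h1 (fun s hs => hT₁ s ((le_max_right _ _).trans hs))
      (y := x⁻¹) (by rw [one_div]; exact inv_anti₀ hx0 hx2)
      (by rw [inv_le_comm₀ hx0 two_pos]; linarith)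
    have e : 1 - 1 / t = tauI k n := by rw [tauI, htdef, one_div_div]
    simp only [e] at h5
    rw [hU x hx0]
    have hD := h'.deriv_pos t (by linarith [h'.pos])
    refine h5.trans ?_
    have h6 : |x⁻¹ - 1| ≤ 2 * |x - 1| := by
      rw [show x⁻¹ - 1 = -((x - 1) / x) by field_simp; ring, abs_neg, abs_div,
        abs_of_pos hx0, div_le_iff₀ hx0]
      nlinarith [abs_nonneg (x - 1)]
    rw [mul_assoc (t * D t)]
    gcongr
  have hD := h'.deriv_pos t (by linarith [h'.pos])
  have hMδ : 0 < M * δ := by positivity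
  have g1 := hinc (1 + M * δ) (by linarith) (by linarith)
  have g2 := hinc (1 - M * δ) (by linarith) (by linarith)
  rw [add_sub_cancel_left, abs_of_pos hMδ] at g1
  rw [show 1 - M * δ - 1 = -(M * δ) by ring, abs_neg, abs_of_pos hMδ] at g2
  rw [abs_div, abs_of_pos (mul_pos ht0 hD), div_le_iff₀ (mul_pos ht0 hD), abs_of_pos hδ0]
  have e : K * (2 * M) * δ * (t * D t) = t * D t * (K * (2 * (M * δ))) := by ring
  rw [e, abs_le]
  constructor
  · linarith [(abs_le.1 g1).1]
  · linarith [(abs_le.1 g2).2]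


/-- Stochastic rate of the ratio of the estimated to the true exceedance probability of the extreme
quantile. -/
theorem bigOP_freqPeakForecaster_ratio {Ω : Type*} [MeasurableSpace Ω] {μ : Measure Ω}
    {X : ℕ → Ω → ℝ} {a D A : ℝ → ℝ} {γ T : ℝ} {k : ℕ → ℕ} {ν : ℕ → ℝ}
    {T₁ T₂ : ∀ n, (Fin (k n + 1) → ℝ) → ℝ} {Q : ℝ → ℝ}
    (h : VonMisesTail (fun t => Q (1 - 1 / t)) D A γ T)
    (ha : ∀ᶠ t in atTop, 0 < a t)
    (hk : Tendsto k atTop atTop) (hkn : (fun n => (k n : ℝ)) =o[atTop] (fun n => (n : ℝ)))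
    (hν : ∀ᶠ n in atTop, 0 < ν n ∧ ν n ≤ k n)
    (hγhat : BigOP μ (fun n ω => estimator X k T₁ n ω - γ) (fun n => 1 / √(k n)))
    (hσhat : BigOP μ (fun n ω => estimator X k T₂ n ω / a (n / k n) - 1) (fun n => 1 / √(k n)))
    (hloc : BigOP μ (fun n ω => (orderStat (sample X n ω) (n - k n) - Q (tauI k n))
        / (n / k n * D (n / k n))) (fun n => 1 / √(k n)))
    {C₁ C₃ : ℝ} (hC₁ : 0 < C₁) (hC₃ : 0 < C₃)
    (hscale : ∀ᶠ n : ℕ in atTop,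
      |n / k n * D (n / k n) / a (n / k n) - 1| ≤ C₃ * (1 / √(k n)))
    (hinc : ∀ᶠ n : ℕ in atTop, |(Q (tauE ν n) - Q (tauI k n)) / (n / k n * D (n / k n))
        - boxCox γ (1 / tauStar k ν n)| ≤ C₁ * (1 / √(k n) *
          ((1 / tauStar k ν n) ^ γ * (1 + weight γ (1 / tauStar k ν n)))))
    (hw : Tendsto (fun n => 1 / √(k n) * (1 + weight γ (1 / tauStar k ν n))) atTop (𝓝 0)) :
    BigOP μ (fun n ω => 1 / tauStar k ν n *
        (1 - freqPeakForecaster X k T₁ T₂ n ω (Q (tauE ν n))) - 1)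
      (fun n => 1 / √(k n) * (1 + weight γ (1 / tauStar k ν n))) := by
  intro θ hθ
  obtain ⟨M₁, hM₁, h₁⟩ := hγhat (θ / 3) (by positivity)
  obtain ⟨M₂, hM₂, h₂⟩ := hσhat (θ / 3) (by positivity)
  obtain ⟨M₃, hM₃, h₃⟩ := hloc (θ / 3) (by positivity)
  obtain ⟨C₅, hC₅, hB⟩ := exists_boxCox_le γ
  set C₆ := 4 * (C₁ + M₃) + 2 * C₅ * (C₃ + M₂)
  obtain ⟨C, c, hC, hc, hcore⟩ := exists_abs_gpStd_ratio_sub_one_le γ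
    (show 0 < max C₆ M₁ from hM₁.trans_le (le_max_right _ _))
  refine ⟨C, hC, ?_⟩
  have ht := tendsto_div_atTop hk hkn
  filter_upwards [h₁, h₂, h₃, hscale, hinc, hν, eventually_ne_atTop 0,
    ht.eventually (eventually_ge_atTop T), ht.eventually ha,
    hw.eventually (ge_mem_nhds hc),
    hw.eventually (ge_mem_nhds (show 0 < 1 / C₃ by positivity)),
    hw.eventually (ge_mem_nhds (show 0 < 1 / 2 / M₂ by positivity))]
    with n e₁ e₂ e₃ hr hz hνn hn hT ha hwc hw3 hw4
  obtain ⟨hτ, hy⟩ := one_div_tauStar_ge_one hn hνn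
  rw [le_div_iff₀ (by positivity)] at hw3 hw4
  set y := 1 / tauStar k ν n
  set δ := 1 / √(k n : ℝ) with hδ
  have hδ0 : 0 ≤ δ := by positivity
  set t := (n : ℝ) / k n
  have hw0 := weight_nonneg γ hy
  have hδW : δ ≤ δ * (1 + weight γ y) := le_mul_of_one_le_right hδ0 (by linarith)
  have hb : 0 < t * D t := mul_pos (h.pos.trans_le hT) (h.deriv_pos t hT)
  -- Outside three events of probability at most `θ / 3` each, all errors are at most fixed
  -- multiples of `δ`, and the deterministic stability bound applies pointwise.
  refine (measure_mono (t := _ ∪ (_ ∪ _)) fun ω hω => ?_).trans ((measure_union_le _ _).trans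
    ((add_le_add e₁ ((measure_union_le _ _).trans (add_le_add e₂ e₃))).trans ?_))
  · by_contra hcon
    simp only [Set.mem_union, Set.mem_ofPred_eq, not_or, not_lt, abs_of_nonneg hδ0] at hcon
    obtain ⟨k₁, k₂, k₃⟩ := hcon
    refine absurd hω ?_
    rw [Set.mem_ofPred_eq, not_lt, abs_of_nonneg (mul_nonneg hδ0 (by linarith))]
    have hE := one_le_rpow_mul_weight γ hy
    have hŷ := abs_mul_div_sub_le hE hC₁.le hM₃.le hz k₃ hr k₂
      ((abs_of_nonneg (boxCox_nonneg γ hy)).le.trans (hB _ hy)) hδ0 (by nlinarith) (by nlinarith)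
    have hsimp : ((Q (tauE ν n) - Q (tauI k n)) / (t * D t) -
        (orderStat (sample X n ω) (n - k n) - Q (tauI k n)) / (t * D t)) * (t * D t / a t) /
        (estimator X k T₂ n ω / a t)
        = (Q (tauE ν n) - orderStat (sample X n ω) (n - k n)) / estimator X k T₂ n ω := by
      rw [← sub_div, sub_sub_sub_cancel_right, div_mul_div_cancel₀ hb.ne',
        div_div_div_cancel_right₀ ha.ne']
    rw [hsimp] at hŷ
    refine hcore δ y _ _ hδ0 hy hwc (k₁.trans (by gcongr; exact le_max_right _ _))
      (hŷ.trans ?_)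
    have : 0 ≤ δ * (y ^ γ * (1 + weight γ y)) := by positivity
    gcongr
    exact le_max_left _ _
  · rw [← ENNReal.ofReal_add (by positivity) (by positivity),
      ← ENNReal.ofReal_add (by positivity) (by positivity)]
    exact ENNReal.ofReal_le_ofReal (by linarith)

/-- The rate `(1 + w) / √k` is at most of the order `ε w`. -/
theorem exists_rate_le_mul_weight {γ τ₀ : ℝ} {k : ℕ → ℕ} {τ ε : ℕ → ℝ}
    (hτ₀0 : 0 ≤ τ₀) (hτ : Tendsto τ atTop (𝓝 τ₀))
    (hτ1 : ∀ᶠ n in atTop, 0 < τ n ∧ 1 ≤ 1 / τ n) (hk : Tendsto k atTop atTop)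
    (hε : ∀ n, 0 < ε n) (hkε : Tendsto (fun n => k n * ε n ^ 2) atTop atTop)
    (h : γ < 0 ∨ τ₀ < 1 ∨ (fun n => 1 / √(k n)) =O[atTop] (fun n => ε n * weight γ (1 / τ n))) :
    ∃ K, 0 < K ∧ ∀ᶠ n in atTop,
      |1 / √(k n) * (1 + weight γ (1 / τ n))| ≤ K * |ε n * weight γ (1 / τ n)| := by
  have hδε : ∀ᶠ n in atTop, 1 / √(k n : ℝ) ≤ ε n := by
    filter_upwards [hkε.eventually (eventually_ge_atTop 1),
      hk.eventually (eventually_gt_atTop 0)] with n hn hkn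
    have hk0 : (0 : ℝ) < k n := by exact_mod_cast hkn
    rw [div_le_iff₀ (Real.sqrt_pos.2 hk0), mul_comm, ← Real.sqrt_sq (hε n).le,
      ← Real.sqrt_mul hk0.le]
    exact Real.one_le_sqrt.2 hn
  -- Once the weight is bounded away from 0, the summand 1 in `1 + w` is a multiple of `w`, and `1 /
  -- √k ≤ ε` concludes.
  have hlow : (∃ w₀, 0 < w₀ ∧ ∀ᶠ n in atTop, w₀ ≤ weight γ (1 / τ n)) →
      ∃ K, 0 < K ∧ ∀ᶠ n in atTop,
        |1 / √(k n) * (1 + weight γ (1 / τ n))| ≤ K * |ε n * weight γ (1 / τ n)| := by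
    rintro ⟨w₀, hw₀, hw⟩
    refine ⟨1 / w₀ + 1, by positivity, ?_⟩
    filter_upwards [hw, hδε] with n h1 h2
    have h3 := hε n
    have h4 : 0 < weight γ (1 / τ n) := hw₀.trans_le h1
    rw [abs_of_nonneg (by positivity), abs_of_nonneg (by positivity)]
    have h5 : 1 + weight γ (1 / τ n) ≤ (1 / w₀ + 1) * weight γ (1 / τ n) := by
      have : 1 ≤ 1 / w₀ * weight γ (1 / τ n) := by
        rw [one_div_mul_eq_div, one_le_div hw₀]; exact h1
      linarith
    calc 1 / √(k n : ℝ) * (1 + weight γ (1 / τ n))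
        ≤ ε n * ((1 / w₀ + 1) * weight γ (1 / τ n)) := by gcongr
      _ = _ := by ring
  rcases h with h | h | h
  · refine hlow ⟨1, one_pos, ?_⟩
    filter_upwards [hτ1] with n hn using one_le_weight_of_neg h hn.2
  -- Eventually `τ` is below the midpoint of `τ₀` and 1, so `1 / τ` stays above a constant larger
  -- than 1, where the weight is positive.
  · have hm : 0 < (1 + τ₀) / 2 := by linarith
    have hm1 : 1 < 1 / ((1 + τ₀) / 2) := by rw [one_lt_div hm]; linarith
    refine hlow ⟨_, weight_pos (γ := γ) hm1, ?_⟩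
    filter_upwards [hτ1, hτ.eventually (ge_mem_nhds (by linarith : τ₀ < (1 + τ₀) / 2))]
      with n hn hn'
    exact weight_monotoneOn γ hm1.le hn.2 (one_div_le_one_div_of_le hn.1 hn')
  -- Here the weight may tend to 0: the assumed bound handles `1 / √k`, and `1 / √k ≤ ε` handles `w
  -- / √k`.
  · obtain ⟨K, hK, hO⟩ := h.exists_pos
    refine ⟨K + 1, by positivity, ?_⟩
    filter_upwards [hO.bound, hδε, hτ1] with n h1 h2 h3
    have h4 := weight_nonneg γ h3.2
    have h5 := hε n
    rw [Real.norm_eq_abs, Real.norm_eq_abs, abs_of_nonneg (by positivity)] at h1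
    rw [abs_of_nonneg (by positivity)]
    rw [abs_of_nonneg (by positivity)] at h1 ⊢
    have := mul_le_mul_of_nonneg_right h2 h4
    linarith

end TailForecast

/-! ### Assembly: the common rate of both tail ratios -/

open TailForecast in
theorem mainTheorem5 {Ω : Type*} [MeasurableSpace Ω] (μ : Measure Ω) [IsProbabilityMeasure μ]
    -- an iid sequence with common distribution function `F`
    (X : ℕ → Ω → ℝ) (hXmeas : ∀ i, Measurable (X i)) (hXindep : iIndepFun X μ)
    (hXident : ∀ i, IdentDistrib (X i) (X 0) μ μ)
    (F : ℝ → ℝ) (hF : F = fun x => cdf (μ.map (X 0)) x)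
    -- the second-order von Mises condition with index `γ > -1/2`
    (a : ℝ → ℝ) (γ ρ : ℝ) (hγ : -1 / 2 < γ) (hSO : SecondOrderVonMises F a γ ρ)
    -- effective sample size and extreme level
    (k : ℕ → ℕ) (hk : Tendsto k atTop atTop)
    (hkn : (fun n => (k n : ℝ)) =o[atTop] (fun n => (n : ℝ)))
    (ν : ℕ → ℝ) (hν : ∀ᶠ n in atTop, 0 < ν n ∧ ν n ≤ k n)
    (τ₀ : ℝ) (hτ₀ : Tendsto (tauStar k ν) atTop (𝓝 τ₀))
    (hmono : ρ = 0 → τ₀ = 0 →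
      ∃ t₀ : ℝ, AntitoneOn (fun t => |vonMisesRate (quantile F) γ t|) (Set.Ici t₀))
    -- the estimators of `γ` and of `σ = a (n / k)` and their rate of convergence
    (T₁ T₂ : ∀ n, (Fin (k n + 1) → ℝ) → ℝ)
    (hT₁ : ∀ n, Measurable (T₁ n)) (hT₂ : ∀ n, Measurable (T₂ n))
    (hγhat : BigOP μ (fun n ω => estimator X k T₁ n ω - γ) (fun n => 1 / √(k n)))
    (hσhat : BigOP μ (fun n ω => estimator X k T₂ n ω / a (n / k n) - 1)
      (fun n => 1 / √(k n)))
    -- the balance condition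
    (lam : ℝ) (hlam : 0 < lam)
    (hbalance : Tendsto (fun n : ℕ => √(k n) * |vonMisesRate (quantile F) γ (n / k n)|)
      atTop (𝓝 lam))
    (hw : (fun n => weight γ (1 / tauStar k ν n)) =o[atTop] (fun n => √(k n))) :
    TailEquivalent μ (tauStar k ν) (freqPeakForecaster X k T₁ T₂)
      (fun n => predictiveCDF μ X n (quantile F (tauI k n))) ∧
    TailEquivalent μ (fun n => 1 - tauE ν n) (freqTailForecaster X k T₁ T₂) (fun _ _ => F) ∧
    ∀ ε : ℕ → ℝ, (∀ n, 0 < ε n) → Tendsto ε atTop (𝓝 0) →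
      Tendsto (fun n => k n * ε n ^ 2) atTop atTop →
      Tendsto (fun n => weight γ (1 / tauStar k ν n) * ε n) atTop (𝓝 0) →
      (γ < 0 ∨ τ₀ < 1 ∨
        (fun n => 1 / √(k n)) =O[atTop] (fun n => ε n * weight γ (1 / tauStar k ν n))) →
      BigOP μ
        (fun n ω => tailRatio (tauStar k ν) (freqPeakForecaster X k T₁ T₂)
          (fun n => predictiveCDF μ X n (quantile F (tauI k n))) n ω - 1)
        (fun n => ε n * weight γ (1 / tauStar k ν n)) ∧
      BigOP μ
        (fun n ω => tailRatio (fun n => 1 - tauE ν n) (freqTailForecaster X k T₁ T₂)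
          (fun _ _ => F) n ω - 1)
        (fun n => ε n * weight γ (1 / tauStar k ν n)) := by
  subst hF
  set Q := quantile fun x => cdf (μ.map (X 0)) x
  set A := vonMisesRate Q γ with hAdef
  have hA : Measurable A := measurable_vonMisesRate Q γ
  obtain ⟨T, hT1, hT, hQc⟩ := hSO.exists_vonMisesTail
  have hSO₂ := hSO.secondOrder
  have ht := tendsto_div_atTop hk hkn
  have hτpos : ∀ᶠ n in atTop, 0 < tauStar k ν n ∧ 1 ≤ 1 / tauStar k ν n := by
    filter_upwards [hν, eventually_ne_atTop 0] with n h1 h2 using one_div_tauStar_ge_one h2 h1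
  have hτ₀0 : 0 ≤ τ₀ := ge_of_tendsto hτ₀ (hτpos.mono fun n hn => hn.1.le)
  -- The balance condition puts the bias on the scale `1 / √k` of the sampling errors, so one small
  -- parameter governs everything.
  have hAδ : ∀ᶠ n : ℕ in atTop, |A (n / k n)| ≤ (lam + 1) * (1 / √(k n)) := by
    filter_upwards [hbalance.eventually (ge_mem_nhds (lt_add_one lam)),
      hk.eventually (eventually_gt_atTop 0)] with n h1 h2
    have : (0 : ℝ) < √(k n) := Real.sqrt_pos.2 (by exact_mod_cast h2)
    rw [mul_one_div, le_div_iff₀ this, mul_comm]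
    exact h1
  obtain ⟨C₂, hC₂, hrate⟩ := exists_rate_le hA hSO₂.A_regVar hSO₂.rho_nonpos hτ₀0 ht hτ₀ hmono
  have hAunif : ∀ᶠ n : ℕ in atTop, ∀ v, 1 ≤ v → v ≤ 1 / tauStar k ν n →
      |A (n / k n * v)| ≤ C₂ * (lam + 1) * (1 / √(k n)) := by
    filter_upwards [hrate, hAδ] with n h1 h2 v hv hvn
    rw [mul_assoc]
    exact (h1 v hv hvn).trans (by gcongr)
  have hδw : Tendsto (fun n => 1 / √(k n) * (1 + weight γ (1 / tauStar k ν n))) atTop (𝓝 0) := by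
    have h1 : Tendsto (fun n => 1 / √(k n : ℝ)) atTop (𝓝 0) := tendsto_one_div_sqrt hk
    have h2 := h1.add hw.tendsto_div_nhds_zero
    rw [add_zero] at h2
    refine h2.congr fun n => ?_
    ring
  obtain ⟨C₁, hC₁, hinc⟩ := hT.exists_abs_increment_sub_boxCox_le ht
    (hτpos.mono fun n hn => hn.2) (fun n => by positivity) hδw
    (show 0 < C₂ * (lam + 1) by positivity) hAunif
  obtain ⟨C₃, hC₃, hscale⟩ := hT.exists_abs_scale_sub_one_le hA hSO₂
  have htauI : ∀ n : ℕ, 1 - 1 / ((n : ℝ) / k n) = tauI k n := fun n => by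
    rw [one_div_div, tauI]
  have hmain := bigOP_freqPeakForecaster_ratio (ν := ν) hT hSO₂.a_pos hk hkn hν hγhat hσhat
    (bigOP_orderStat_sub_quantile hXmeas hXindep hXident hT1 hT hSO₂.A_tendsto hk hkn) hC₁
    (show 0 < C₃ * (lam + 1) by positivity) ?_ ?_ hδw
  rotate_left
  · filter_upwards [ht.eventually hscale, hAδ] with n h1 h2
    rw [mul_assoc]
    exact h1.trans (by gcongr)
  · filter_upwards [hinc, hν, eventually_ne_atTop 0] with n h1 h2 h3
    have h4 : 1 - 1 / ((n : ℝ) / k n * (1 / tauStar k ν n)) = tauE ν n := by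
      have h5 : (0 : ℝ) < k n := h2.1.trans_le h2.2
      have h6 : (n : ℝ) ≠ 0 := by exact_mod_cast h3
      have := h2.1.ne'
      rw [tauStar_eq h3, tauE]
      field_simp
    rw [htauI, h4] at h1
    exact h1
  have hpeak : BigOP μ (fun n ω => tailRatio (tauStar k ν) (freqPeakForecaster X k T₁ T₂)
      (fun n => predictiveCDF μ X n (Q (tauI k n))) n ω - 1)
      (fun n => 1 / √(k n) * (1 + weight γ (1 / tauStar k ν n))) := by
    refine hmain.congr_ae ?_
    filter_upwards [hν, eventually_ne_atTop 0, ht.eventually (eventually_gt_atTop T)]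
      with n h1 h2 h3
    have hp₀ : 0 ≤ 1 - 1 / T := by
      have : 1 / T ≤ 1 := by rw [div_le_one (by linarith)]; exact hT1
      linarith
    have hp : tauI k n ∈ Set.Ioo (1 - 1 / T) 1 := by
      rw [← htauI]
      have h4 := one_div_lt_one_div_of_lt hT.pos h3
      have h5 : 0 < 1 / ((n : ℝ) / k n) := one_div_pos.2 (hT.pos.trans h3)
      exact ⟨by linarith, by linarith⟩
    have hc := hQc _ h3.le
    rw [htauI] at hc
    filter_upwards [ae_tailRatio_freqPeakForecaster hXmeas hXindep hXident T₁ T₂ h2 h1 hp₀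
      hT.strictMonoOn_of_comp hp hc] with ω hω
    rw [← hω]
  have htail : BigOP μ (fun n ω => tailRatio (fun n => 1 - tauE ν n)
      (freqTailForecaster X k T₁ T₂) (fun _ _ => fun x => cdf (μ.map (X 0)) x) n ω - 1)
      (fun n => 1 / √(k n) * (1 + weight γ (1 / tauStar k ν n))) := by
    refine hmain.congr_ae ?_
    filter_upwards [hν, eventually_ne_atTop 0] with n h1 h2
    refine Eventually.of_forall fun ω => ?_
    dsimp only
    rw [tailRatio_freqTailForecaster X _ T₁ T₂ ω h2 h1]
  refine ⟨hpeak.tendstoInMeasure_one hδw, htail.tendstoInMeasure_one hδw,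
    fun ε hε _ hkε _ hcase => ?_⟩
  obtain ⟨K, hK, hle⟩ := exists_rate_le_mul_weight hτ₀0 hτ₀ hτpos hk hε hkε hcase
  exact ⟨hpeak.mono hK hle, htail.mono hK hle⟩
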